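/- \textbf{Definitions.} An \emph{involutive residuated lattice} (IRL) is an algebra $\langle A;\cdot,\wedge,\vee,\neg,e\rangle$ where $\langle A;\cdot,e\rangle$ is a commutative monoid, $\langle A;\wedge,\vee\rangle$ is a lattice, $\neg\neg x=x$, and $x\cdot y\le z \iff \neg z\cdot y\le\neg x$. Put $f:=\neg e$, $x\to y:=\neg(x\cdot\neg y)$, $x^*:=x\to e$, $x^2:=x\cdot x$. A \emph{residuated lattice} (RL) is an algebra $\langle A;\cdot,\to,\wedge,\vee,e\rangle$ with the same monoid and lattice conditions and $x\cdot y\le z\iff y\le x\to z$; here too $x^*:=x\to e$. An [I]RL is \emph{semilinear} if it is isomorphic to a subdirect product of totally ordered [I]RLs, \emph{idempotent} if $x^2=x$ for all $x$, and \emph{finitely subdirectly irreducible} (FSI) if its identity relation is meet-irreducible in its congruence lattice (trivial algebras are FSI). A \emph{De Morgan monoid} is an IRL whose lattice is distributive and that satisfies $x\le x^2$; it is \emph{negatively generated} if it is generated, as an algebra, by $\{a: a\le e\}$. A \emph{Sugihara monoid} is an idempotent De Morgan monoid; it is \emph{odd} if $\neg e=e$. A \emph{generalized Sugihara monoid} is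 a semilinear idempotent RL satisfying $(x\vee e)^{**}=x\vee e$. (Odd Sugihara monoids and generalized Sugihara monoids are FSI exactly when they are totally ordered.) For a generalized Sugihara monoid $D$, the \emph{reflection} $R(D)$ is the algebra on $D\cup D'\cup\{0,1\}$, where $D'=\{a':a\in D\}$ is a disjoint copy of $D$ and $0,1$ are new elements, with $0<a<b'<1$ for $a,b\in D$, the order of $D$ on $D$ and the reverse order on $D'$; neutral element $e^D$; $\neg a=a'$, $\neg a'=a$, $\neg 0=1$, $\neg 1=0$; and the commutative operation $\cdot$ that extends that of $D$ and satisfies $x\cdot 0=0$, $x\cdot 1=1$ for $x\neq 0$, $a\cdot b'=(a\to b)'$, $a'\cdot b'=1$. For a totally ordered odd Sugihara monoid $S$ and a De Morgan monoid $B$, the \emph{rigorous extension} $S[B]$ is the algebra on the disjoint union $(S\setminus\{e^S\})\cup B$ with neutral element $e^B$ whose operations extend those of $S$ (on $S\setminus\{e^S\}$) and of $B$, and in which, for $\star\in\{\wedge,\vee,\cdot\}$, $s\in S\setminus\{e^S\}$ and $a\in B$, the element $a\star s=s\star a$ is $a$ if $e^S\star^S s=e^S$, and is $e^S\star^S s$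 otherwise. Define the unary terms \[ d'(x)=(f^2\to(x\cdot f))\wedge(f^2\cdot\neg x),\quad \sigma(x)=(x\wedge e)\cdot(x^*\wedge e)^*,\quad d(x)=d'(\neg x),\quad \sigma'(x)=\neg\sigma(\neg x). \] \textbf{Theorem.} Let $A$ be a semilinear De Morgan monoid. The following are equivalent: \begin{enumerate} \item[(i)] $A$ is negatively generated; \item[(ii)] $A$ is (isomorphic to) a subdirect product of algebras each of which is a totally ordered Sugihara monoid or is isomorphic to $S[R(D)]$ for some FSI odd Sugihara monoid $S$ and some FSI generalized Sugihara monoid $D$; \item[(iii)] $A$ satisfies the equation \[ x=\big(d(\sigma(x))\wedge\sigma(x)\big)\vee\big(d'(\sigma'(x))\wedge\sigma'(x)\big)\vee\Big(\big(f^2\vee\neg(f^2)\big)\to\sigma'(x)\Big). \] \end{enumerate} -/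

import Mathlib

universe u

namespace DeMorgan

/-- Involutive (commutative) residuated lattices. The neutral element `e` is `1`, fusion is `*`,
the lattice operations are `⊓`, `⊔`, and the involution is `ᶜ`. -/
class IRL (A : Type u) extends CommMonoid A, Lattice A, Compl A where
  compl_compl' : ∀ x : A, xᶜᶜ = x
  fusion_law : ∀ x y z : A, x * y ≤ z ↔ zᶜ * y ≤ xᶜ

/-- (Commutative) residuated lattices; the residual is `⇨`. -/
class RL (A : Type u) extends CommMonoid A, Lattice A, HImp A where
  residuation : ∀ x y z : A, x * y ≤ z ↔ y ≤ x ⇨ z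

/-- The order of a lattice is total. -/
def IsChainAlgebra (A : Type u) [LE A] : Prop := ∀ x y : A, x ≤ y ∨ y ≤ x

section Involutive

/-- Homomorphisms for the signature `*, ⊓, ⊔, ᶜ, 1`. -/
structure IsIRLHom {A B : Type u} [Mul A] [One A] [Min A] [Max A] [Compl A]
    [Mul B] [One B] [Min B] [Max B] [Compl B] (h : A → B) : Prop where
  map_mul : ∀ x y, h (x * y) = h x * h y
  map_inf : ∀ x y, h (x ⊓ y) = h x ⊓ h y
  map_sup : ∀ x y, h (x ⊔ y) = h x ⊔ h y
  map_compl : ∀ x, h xᶜ = (h x)ᶜ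
  map_one : h 1 = 1

/-- `A` is (isomorphic to) a subdirect product of IRLs that have the property `P`. -/
def IsSubdirectProductOf (P : (B : Type u) → [IRL B] → Prop) (A : Type u) [IRL A] : Prop :=
  ∃ (I : Type u) (B : I → Type u) (_ : ∀ i, IRL (B i)) (p : ∀ i, A → B i),
    (∀ i, P (B i)) ∧ (∀ i, IsIRLHom (p i)) ∧ (∀ i, Function.Surjective (p i)) ∧
      ∀ a b : A, (∀ i, p i a = p i b) → a = b

/-- An IRL is semilinear if it is a subdirect product of totally ordered IRLs. -/
def IsSemilinear (A : Type u) [IRL A] : Prop :=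
  IsSubdirectProductOf (fun B _ => IsChainAlgebra B) A

/-- De Morgan monoids: distributive square-increasing IRLs. -/
structure IsDeMorganMonoid (A : Type u) [IRL A] : Prop where
  distrib : ∀ x y z : A, x ⊓ (y ⊔ z) = (x ⊓ y) ⊔ (x ⊓ z)
  square_increasing : ∀ x : A, x ≤ x ^ 2

/-- Sugihara monoids: idempotent De Morgan monoids. -/
structure IsSugiharaMonoid (A : Type u) [IRL A] : Prop extends IsDeMorganMonoid A where
  idempotent : ∀ x : A, x ^ 2 = x

/-- Odd Sugihara monoids: Sugihara monoids in which `e = ¬e`. -/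
structure IsOddSugiharaMonoid (A : Type u) [IRL A] : Prop extends IsSugiharaMonoid A where
  odd : (1 : A)ᶜ = 1

/-- Congruences of an IRL. -/
structure IsIRLCongruence {A : Type u} [IRL A] (θ : Setoid A) : Prop where
  mul : ∀ a b c d : A, θ a b → θ c d → θ (a * c) (b * d)
  inf : ∀ a b c d : A, θ a b → θ c d → θ (a ⊓ c) (b ⊓ d)
  sup : ∀ a b c d : A, θ a b → θ c d → θ (a ⊔ c) (b ⊔ d)
  compl : ∀ a b : A, θ a b → θ aᶜ bᶜ

/-- An IRL is finitely subdirectly irreducible if its identity relation is meet-irreducible in its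
congruence lattice (trivial algebras are included). -/
def IsIRLFSI (A : Type u) [IRL A] : Prop :=
  ∀ θ φ : Setoid A, IsIRLCongruence θ → IsIRLCongruence φ → θ ⊓ φ = ⊥ → θ = ⊥ ∨ φ = ⊥

/-- Subuniverses of an IRL. -/
structure IsSubuniverse {A : Type u} [IRL A] (T : Set A) : Prop where
  one_mem : 1 ∈ T
  mul_mem : ∀ x ∈ T, ∀ y ∈ T, x * y ∈ T
  inf_mem : ∀ x ∈ T, ∀ y ∈ T, x ⊓ y ∈ T
  sup_mem : ∀ x ∈ T, ∀ y ∈ T, x ⊔ y ∈ T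
  compl_mem : ∀ x ∈ T, xᶜ ∈ T

/-- The subuniverse generated by a set. -/
def generated {A : Type u} [IRL A] (X : Set A) : Set A :=
  ⋂₀ {T : Set A | IsSubuniverse T ∧ X ⊆ T}

/-- `A` is generated by the lower bounds of its neutral element. -/
def IsNegativelyGenerated (A : Type u) [IRL A] : Prop :=
  generated {a : A | a ≤ 1} = Set.univ

end Involutive

section NonInvolutive

/-- Homomorphisms for the signature `*, ⇨, ⊓, ⊔, 1`. -/
structure IsRLHom {A B : Type u} [RL A] [RL B] (h : A → B) : Prop where
  map_mul : ∀ x y, h (x * y) = h x * h y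
  map_himp : ∀ x y, h (x ⇨ y) = h x ⇨ h y
  map_inf : ∀ x y, h (x ⊓ y) = h x ⊓ h y
  map_sup : ∀ x y, h (x ⊔ y) = h x ⊔ h y
  map_one : h 1 = 1

/-- An RL is semilinear if it is (isomorphic to) a subdirect product of totally ordered RLs. -/
def IsRLSemilinear (A : Type u) [RL A] : Prop :=
  ∃ (I : Type u) (B : I → Type u) (_ : ∀ i, RL (B i)) (p : ∀ i, A → B i),
    (∀ i, IsChainAlgebra (B i)) ∧ (∀ i, IsRLHom (p i)) ∧ (∀ i, Function.Surjective (p i)) ∧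
      ∀ a b : A, (∀ i, p i a = p i b) → a = b

/-- Generalized Sugihara monoids: semilinear idempotent RLs with `(x ∨ e)** = x ∨ e`, where
`x* = x → e`. -/
structure IsGeneralizedSugiharaMonoid (A : Type u) [RL A] : Prop where
  semilinear : IsRLSemilinear A
  idempotent : ∀ x : A, x ^ 2 = x
  star_star : ∀ x : A, ((x ⊔ 1) ⇨ 1) ⇨ 1 = x ⊔ 1

/-- Congruences of an RL. -/
structure IsRLCongruence {A : Type u} [RL A] (θ : Setoid A) : Prop where
  mul : ∀ a b c d : A, θ a b → θ c d → θ (a * c) (b * d)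
  himp : ∀ a b c d : A, θ a b → θ c d → θ (a ⇨ c) (b ⇨ d)
  inf : ∀ a b c d : A, θ a b → θ c d → θ (a ⊓ c) (b ⊓ d)
  sup : ∀ a b c d : A, θ a b → θ c d → θ (a ⊔ c) (b ⊔ d)

/-- An RL is finitely subdirectly irreducible if its identity relation is meet-irreducible in its
congruence lattice (trivial algebras are included). -/
def IsRLFSI (A : Type u) [RL A] : Prop :=
  ∀ θ φ : Setoid A, IsRLCongruence θ → IsRLCongruence φ → θ ⊓ φ = ⊥ → θ = ⊥ ∨ φ = ⊥

end NonInvolutive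

/-- The universe of the reflection of `D`: the elements `a` of `D` (`low a`), a disjoint copy
`a'` (`high a`), and new bounds `0` (`bot`) and `1` (`top`). -/
inductive Reflection (D : Type u) : Type u where
  | bot : Reflection D
  | low (a : D) : Reflection D
  | high (a : D) : Reflection D
  | top : Reflection D

namespace Reflection

variable {D : Type u} [RL D]

instance : One (Reflection D) := ⟨low 1⟩

instance : Mul (Reflection D) where
  mul
    | bot, _ => bot
    | _, bot => bot
    | top, _ => top
    | _, top => top
    | low a, low b => low (a * b)
    | low a, high b => high (a ⇨ b)
    | high a, low b => high (b ⇨ a)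
    | high _, high _ => top

instance : Compl (Reflection D) where
  compl
    | bot => top
    | low a => high a
    | high a => low a
    | top => bot

/-- Meet for the order `0 < a < b' < 1`, which extends that of `D` and reverses it on the copy. -/
instance : Min (Reflection D) where
  min
    | bot, _ => bot
    | _, bot => bot
    | top, x => x
    | x, top => x
    | low a, low b => low (a ⊓ b)
    | low a, high _ => low a
    | high _, low b => low b
    | high a, high b => high (a ⊔ b)

/-- Join for the same order. -/
instance : Max (Reflection D) where
  max
    | top, _ => top
    | _, top => top
    | bot, x => x
    | x, bot => x
    | low a, low b => low (a ⊔ b)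
    | low _, high b => high b
    | high a, low _ => high a
    | high a, high b => high (a ⊓ b)

end Reflection

/-- The universe `(S \ {e}) ∪ A` (a disjoint union) of the rigorous extension `S[A]`. -/
inductive RigorousExtension (S A : Type u) [One S] : Type u where
  | outer (s : S) (hs : s ≠ 1) : RigorousExtension S A
  | inner (a : A) : RigorousExtension S A

namespace RigorousExtension

variable {S A : Type u} [IRL S] [One A]

open Classical in
/-- A binary operation on `S[A]` from one on `S` and one on `A`. The clause for `outer`, `outer`
with value `e` never applies to the operations of a totally ordered odd Sugihara monoid `S`. -/
noncomputable def extend (opS : S → S → S) (opA : A → A → A) :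
    RigorousExtension S A → RigorousExtension S A → RigorousExtension S A
  | outer s _, outer p _ => if h : opS s p = 1 then inner 1 else outer (opS s p) h
  | inner a, inner b => inner (opA a b)
  | inner a, outer s _ => if h : opS 1 s = 1 then inner a else outer (opS 1 s) h
  | outer s _, inner a => if h : opS 1 s = 1 then inner a else outer (opS 1 s) h

instance : One (RigorousExtension S A) := ⟨inner 1⟩

noncomputable instance [Mul A] : Mul (RigorousExtension S A) := ⟨extend (· * ·) (· * ·)⟩

noncomputable instance [Min A] : Min (RigorousExtension S A) := ⟨extend (· ⊓ ·) (· ⊓ ·)⟩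

noncomputable instance [Max A] : Max (RigorousExtension S A) := ⟨extend (· ⊔ ·) (· ⊔ ·)⟩

open Classical in
/-- The clause with value `e` never applies when `S` is odd. -/
noncomputable instance [Compl A] : Compl (RigorousExtension S A) where
  compl
    | outer s _ => if h : sᶜ = 1 then inner 1 else outer sᶜ h
    | inner a => inner aᶜ

end RigorousExtension

/-- `B` is isomorphic to `S[R(D)]` for some finitely subdirectly irreducible odd Sugihara monoid
`S` and some finitely subdirectly irreducible generalized Sugihara monoid `D`. -/
def IsRigorousReflection (B : Type u) [IRL B] : Prop :=
  ∃ (S D : Type u) (_ : IRL S) (_ : RL D),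
    IsOddSugiharaMonoid S ∧ IsIRLFSI S ∧ IsGeneralizedSugiharaMonoid D ∧ IsRLFSI D ∧
      ∃ φ : B → RigorousExtension S (Reflection D), IsIRLHom φ ∧ Function.Bijective φ

/-- `B` is a totally ordered Sugihara monoid or of the form `S[R(D)]`. -/
def IsSugiharaChainOrRigorousReflection (B : Type u) [IRL B] : Prop :=
  (IsSugiharaMonoid B ∧ IsChainAlgebra B) ∨ IsRigorousReflection B

section Terms

variable {A : Type u} [IRL A]

/-- The constant `f = ¬e`. -/
def f (A : Type u) [IRL A] : A := (1 : A)ᶜ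

/-- The residual `x → y = ¬(x · ¬y)`. -/
def imp (x y : A) : A := (x * yᶜ)ᶜ

/-- `x* = x → e`. -/
def star (x : A) : A := imp x 1

/-- `d'(x) = (f² → (x · f)) ∧ (f² · ¬x)`. -/
def d' (x : A) : A := imp (f A ^ 2) (x * f A) ⊓ (f A ^ 2 * xᶜ)

/-- `σ(x) = (x ∧ e) · (x* ∧ e)*`. -/
def sigma (x : A) : A := (x ⊓ 1) * star (star x ⊓ 1)

/-- `d(x) = d'(¬x)`. -/
def d (x : A) : A := d' xᶜ

/-- `σ'(x) = ¬σ(¬x)`. -/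
def sigma' (x : A) : A := (sigma xᶜ)ᶜ

end Terms

/-- The equation
`x = (d(σ(x)) ∧ σ(x)) ∨ (d'(σ'(x)) ∧ σ'(x)) ∨ ((f² ∨ ¬(f²)) → σ'(x))` holds in `A`. -/
def SatisfiesNegcone (A : Type u) [IRL A] : Prop :=
  ∀ x : A, x = (d (sigma x) ⊓ sigma x) ⊔ (d' (sigma' x) ⊓ sigma' x) ⊔
    imp (f A ^ 2 ⊔ (f A ^ 2)ᶜ) (sigma' x)

end DeMorgan

/-! Everything is reduced to the totally ordered factors of `A`: negative generation passes to
homomorphic images, and the equation lifts back through a subdirect representation.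

Consider a square-increasing chain. If f ≤ e, it is idempotent, hence Sugihara. Otherwise e < f, and
every element outside [¬(f²), f²] is idempotent and absorbs the elements of this interval
(`outerSet_mul_inner`); the outside elements together with e form S. Inside the interval, D consists
of the x with ¬(f²) < x, ¬(f²) < x*, and x ≤ e or x** = x. Its elements are idempotent and closed
under residuals (`imp_mem_coreSet`), they lie below all complements of elements of D (`lt_compl`),
and any two such complements multiply to f² (`compl_mul_compl`). These are the operation tables of
S[R(D)], so the outside elements, D, its complements and the bounds ¬(f²), f² form a subalgebra. It
contains the negative cone, so it is the whole chain when the chain is negatively generated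
(`mem_of_isNegativelyGenerated`).

For the equation, σ(x) is a term in the negative elements x ∧ e and x* ∧ e, so the right-hand side
lies in the subalgebra generated by the negative cone; this gives (iii) ⇒ (i). In S[R(D)], σ sends
D' to the top of R(D) and fixes everything else; dually, σ' sends D to the bottom and fixes
everything else. On R(D), the terms d and d' are the indicators of D and D', with values 0 and 1.
Hence the first joinand recovers D, the second D', and the third the outer elements and the bounds.
In a Sugihara chain σ and σ' are the identity and the third joinand is already x. -/

namespace DeMorgan

/-! ### Idempotents in totally ordered commutative monoids. -/

section OrderedMonoid

variable {M : Type u} [CommMonoid M] [PartialOrder M] [IsOrderedMonoid M]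

/-- For x ≤ y the product lies in [x, y]. Compare it with 1: multiplying x * y ≤ 1 by x pushes the
product down to x, and multiplying 1 ≤ x * y by y pushes it up to y. -/
theorem mul_eq_left_or_right (hch : IsChainAlgebra M) {x y : M} (hx : x * x = x)
    (hy : y * y = y) : x * y = x ∨ x * y = y := by
  wlog hxy : x ≤ y generalizing x y
  · have := this hy hx ((hch x y).resolve_left hxy)
    rw [mul_comm]
    exact this.symm
  have h1 : x ≤ x * y := by simpa [hx] using mul_le_mul_right hxy x
  have h2 : x * y ≤ y := by simpa [hy] using mul_le_mul_left hxy y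
  rcases hch (x * y) 1 with h | h
  · left
    refine le_antisymm ?_ h1
    have := mul_le_mul_right h x
    rwa [← mul_assoc, hx, mul_one] at this
  · right
    refine le_antisymm h2 ?_
    have := mul_le_mul_right h y
    rwa [mul_left_comm, hy, mul_one] at this

end OrderedMonoid

theorem IsChainAlgebra.lt_of_not_le {A : Type u} [Preorder A] (hch : IsChainAlgebra A) {x y : A}
    (h : ¬ x ≤ y) : y < x :=
  lt_of_le_not_ge ((hch x y).resolve_left h) h

/-! ### Arithmetic of involutive residuated lattices. -/

section IRL

variable {A : Type u} [IRL A]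

@[simp] theorem compl_compl_eq (x : A) : xᶜᶜ = x := IRL.compl_compl' x

theorem compl_le_compl_iff' {x y : A} : xᶜ ≤ yᶜ ↔ y ≤ x := by
  have := IRL.fusion_law y 1 x
  simpa using this.symm

theorem compl_lt_compl_iff' {x y : A} : xᶜ < yᶜ ↔ y < x := by
  simp only [lt_iff_le_not_ge, compl_le_compl_iff']

theorem compl_injective' : Function.Injective (compl : A → A) :=
  Function.LeftInverse.injective compl_compl_eq

theorem le_compl_comm' {x y : A} : x ≤ yᶜ ↔ y ≤ xᶜ := by
  rw [← compl_le_compl_iff', compl_compl_eq]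

theorem compl_le_comm' {x y : A} : xᶜ ≤ y ↔ yᶜ ≤ x := by
  rw [← compl_le_compl_iff', compl_compl_eq]

theorem compl_inf' (x y : A) : (x ⊓ y)ᶜ = xᶜ ⊔ yᶜ := by
  apply le_antisymm
  · rw [compl_le_comm']
    exact le_inf (by rw [compl_le_comm']; exact le_sup_left)
      (by rw [compl_le_comm']; exact le_sup_right)
  · exact sup_le (compl_le_compl_iff'.2 inf_le_left) (compl_le_compl_iff'.2 inf_le_right)

theorem mul_le_iff_le_imp {x y z : A} : x * y ≤ z ↔ y ≤ imp x z := by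
  rw [mul_comm, IRL.fusion_law, le_compl_comm', imp, mul_comm]

theorem mul_le_f_iff {x y : A} : x * y ≤ f A ↔ x ≤ yᶜ := by
  rw [mul_comm, f, IRL.fusion_law]; simp

instance : IsOrderedMonoid A where
  mul_le_mul_left x y h w := by
    rw [mul_comm x, mul_comm y, mul_le_iff_le_imp]
    exact h.trans (mul_le_iff_le_imp.1 le_rfl)

theorem mul_compl_le_f (x : A) : x * xᶜ ≤ f A := by
  rw [mul_le_f_iff, compl_compl_eq]

theorem le_iff_mul_compl_le_f {x y : A} : x ≤ y ↔ x * yᶜ ≤ f A := by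
  rw [mul_le_f_iff, compl_compl_eq]

theorem mul_imp_le (x y : A) : x * imp x y ≤ y := mul_le_iff_le_imp.2 le_rfl

theorem mul_star_le (x : A) : x * star x ≤ 1 := mul_imp_le x 1

theorem star_eq (x : A) : star x = (x * f A)ᶜ := rfl

theorem le_star_iff {x y : A} : y ≤ star x ↔ x * y ≤ 1 := mul_le_iff_le_imp.symm

theorem le_star_star (x : A) : x ≤ star (star x) := by
  rw [le_star_iff, mul_comm]; exact mul_star_le x

theorem star_anti {x y : A} (h : x ≤ y) : star y ≤ star x :=
  le_star_iff.2 ((mul_le_mul_left h _).trans (mul_star_le y))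

theorem star_star_star (x : A) : star (star (star x)) = star x :=
  le_antisymm (star_anti (le_star_star x)) (le_star_star _)

@[simp] theorem compl_f : (f A)ᶜ = 1 := compl_compl_eq 1

@[simp] theorem star_one : star (1 : A) = 1 := by simp [star_eq]

theorem one_le_star {x : A} (h : x ≤ 1) : 1 ≤ star x := by simpa using star_anti h

theorem star_le_one {x : A} (h : 1 ≤ x) : star x ≤ 1 := by simpa using star_anti h

theorem imp_imp (x y z : A) : imp x (imp y z) = imp (x * y) z := by
  simp [imp, mul_assoc]

theorem one_le_imp {x y : A} : 1 ≤ imp x y ↔ x ≤ y := by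
  rw [← mul_le_iff_le_imp, mul_one]

end IRL

/-! ### Arithmetic of residuated lattices. -/

section RL

variable {D : Type u} [RL D]

instance : IsOrderedMonoid D where
  mul_le_mul_left x y h w := by
    rw [mul_comm x, mul_comm y, RL.residuation]
    exact h.trans ((RL.residuation _ _ _).1 le_rfl)

theorem mul_himp_le' (x y : D) : x * (x ⇨ y) ≤ y := (RL.residuation _ _ _).2 le_rfl

theorem himp_mono_anti {x y z w : D} (h : x ≤ y) (h' : z ≤ w) : y ⇨ z ≤ x ⇨ w :=
  (RL.residuation _ _ _).1 ((mul_le_mul_left h _).trans ((mul_himp_le' y z).trans h'))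

@[simp] theorem one_himp' (x : D) : (1 : D) ⇨ x = x :=
  le_antisymm (by simpa using mul_himp_le' 1 x) ((RL.residuation _ _ _).1 (by simp))

theorem one_le_himp {x y : D} : 1 ≤ x ⇨ y ↔ x ≤ y := by
  rw [← RL.residuation, mul_one]

end RL

/-! ### Finite subdirect irreducibility versus total order. -/

section FSI

/-- A totally ordered IRL is finitely subdirectly irreducible. -/
theorem IsChainAlgebra.isIRLFSI {A : Type u} [IRL A] (hch : IsChainAlgebra A) : IsIRLFSI A := by
  have key : ∀ θ : Setoid A, IsIRLCongruence θ → θ ≠ ⊥ → ∃ c : A, ¬ 1 ≤ c ∧ c ≤ 1 ∧ θ c 1 := by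
    intro θ hθ hne
    obtain ⟨a, b, hab, hn⟩ : ∃ a b, θ a b ∧ ¬ b ≤ a := by
      by_contra! hcon
      exact hne (le_bot_iff.1 fun a b hab => le_antisymm (hcon b a (θ.symm hab)) (hcon a b hab))
    -- The witness (b → a) ∧ 1 is congruent to (b → b) ∧ 1 = 1, and it is not above 1 because b ≰ a.
    refine ⟨imp b a ⊓ 1, fun h => hn (one_le_imp.1 (h.trans inf_le_left)), inf_le_right, ?_⟩
    have h1 : θ (imp b a) (imp b b) :=
      hθ.compl _ _ (hθ.mul _ _ _ _ (θ.refl b) (hθ.compl _ _ hab))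
    have h2 := hθ.inf _ _ _ _ h1 (θ.refl 1)
    rwa [inf_eq_right.2 (one_le_imp.2 (le_refl b))] at h2
  intro θ φ hθ hφ hbot
  by_contra! hcon
  obtain ⟨c, hc1, hc2, hc⟩ := key θ hθ hcon.1
  obtain ⟨d, hd1, hd2, hd⟩ := key φ hφ hcon.2
  -- Congruence classes are convex, so the larger of `c` and `d` is identified with 1 by both
  -- congruences.
  rcases hch c d with h | h
  · have h3 := hθ.sup _ _ _ _ hc (θ.refl d)
    rw [sup_eq_right.2 h, sup_eq_left.2 hd2] at h3
    have : (θ ⊓ φ) d 1 := ⟨h3, hd⟩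
    rw [hbot] at this
    exact hd1 (le_of_eq (Eq.symm this))
  · have h3 := hφ.sup _ _ _ _ hd (φ.refl c)
    rw [sup_eq_right.2 h, sup_eq_left.2 hc2] at h3
    have : (θ ⊓ φ) c 1 := ⟨hc, h3⟩
    rw [hbot] at this
    exact hc1 (le_of_eq (Eq.symm this))

/-- A totally ordered RL is finitely subdirectly irreducible. -/
theorem IsChainAlgebra.isRLFSI {A : Type u} [RL A] (hch : IsChainAlgebra A) : IsRLFSI A := by
  have key : ∀ θ : Setoid A, IsRLCongruence θ → θ ≠ ⊥ → ∃ c : A, ¬ 1 ≤ c ∧ c ≤ 1 ∧ θ c 1 := by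
    intro θ hθ hne
    obtain ⟨a, b, hab, hn⟩ : ∃ a b, θ a b ∧ ¬ b ≤ a := by
      by_contra! hcon
      exact hne (le_bot_iff.1 fun a b hab => le_antisymm (hcon b a (θ.symm hab)) (hcon a b hab))
    refine ⟨(b ⇨ a) ⊓ 1, fun h => hn (one_le_himp.1 (h.trans inf_le_left)), inf_le_right, ?_⟩
    have h1 : θ (b ⇨ a) (b ⇨ b) := hθ.himp _ _ _ _ (θ.refl b) hab
    have h2 := hθ.inf _ _ _ _ h1 (θ.refl 1)
    rwa [inf_eq_right.2 (one_le_himp.2 (le_refl b))] at h2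
  intro θ φ hθ hφ hbot
  by_contra! hcon
  obtain ⟨c, hc1, hc2, hc⟩ := key θ hθ hcon.1
  obtain ⟨d, hd1, hd2, hd⟩ := key φ hφ hcon.2
  rcases hch c d with h | h
  · have h3 := hθ.sup _ _ _ _ hc (θ.refl d)
    rw [sup_eq_right.2 h, sup_eq_left.2 hd2] at h3
    have : (θ ⊓ φ) d 1 := ⟨h3, hd⟩
    rw [hbot] at this
    exact hd1 (le_of_eq (Eq.symm this))
  · have h3 := hφ.sup _ _ _ _ hd (φ.refl c)
    rw [sup_eq_right.2 h, sup_eq_left.2 hc2] at h3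
    have : (θ ⊓ φ) c 1 := ⟨hc, h3⟩
    rw [hbot] at this
    exact hc1 (le_of_eq (Eq.symm this))

/-- The congruence generated by identifying the idempotent `c ≤ 1` with `1`. -/
def idempotentSetoid {M : Type u} [CommMonoid M] [PartialOrder M] [IsOrderedMonoid M] (c : M)
    (hc : c ≤ 1) (hcc : c * c = c) : Setoid M where
  r x y := c * x ≤ y ∧ c * y ≤ x
  iseqv :=
    { refl := fun x => ⟨mul_le_of_le_one_left' hc, mul_le_of_le_one_left' hc⟩
      symm := fun h => ⟨h.2, h.1⟩
      trans := by
        have aux : ∀ {x y z : M}, c * x ≤ y → c * y ≤ z → c * x ≤ z := fun {x y z} h1 h2 => by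
          rw [← hcc, mul_assoc]
          exact (mul_le_mul_right h1 c).trans h2
        exact fun {_ _ _} h1 h2 => ⟨aux h1.1 h2.1, aux h2.2 h1.2⟩ }

theorem idempotentSetoid_eq_bot {M : Type u} [CommMonoid M] [PartialOrder M] [IsOrderedMonoid M]
    {c : M} {hc : c ≤ 1} {hcc : c * c = c} (h : idempotentSetoid c hc hcc = ⊥) : c = 1 := by
  have : idempotentSetoid c hc hcc c 1 := ⟨by rwa [hcc], by rw [mul_one]⟩
  rw [h] at this
  exact this

theorem idempotentSetoid_mul {M : Type u} [CommMonoid M] [PartialOrder M] [IsOrderedMonoid M]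
    {c : M} (hcc : c * c = c) {x y z w : M} (h : c * x ≤ y) (h' : c * z ≤ w) :
    c * (x * z) ≤ y * w := by
  calc c * (x * z) = (c * x) * (c * z) := by rw [mul_mul_mul_comm, hcc]
    _ ≤ _ := mul_le_mul' h h'

theorem isIRLCongruence_idempotentSetoid {A : Type u} [IRL A] (c : A) (hc : c ≤ 1)
    (hcc : c * c = c) : IsIRLCongruence (idempotentSetoid c hc hcc) where
  mul _ _ _ _ h h' := ⟨idempotentSetoid_mul hcc h.1 h'.1, idempotentSetoid_mul hcc h.2 h'.2⟩
  inf _ _ _ _ h h' :=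
    ⟨le_inf ((mul_le_mul_right inf_le_left c).trans h.1)
      ((mul_le_mul_right inf_le_right c).trans h'.1),
    le_inf ((mul_le_mul_right inf_le_left c).trans h.2)
      ((mul_le_mul_right inf_le_right c).trans h'.2)⟩
  sup _ _ _ _ h h' := by
    constructor <;> rw [mul_le_iff_le_imp] <;> refine sup_le ?_ ?_ <;> rw [← mul_le_iff_le_imp]
    exacts [h.1.trans le_sup_left, h'.1.trans le_sup_right, h.2.trans le_sup_left,
      h'.2.trans le_sup_right]
  compl a b h := by
    have aux : ∀ {a b : A}, c * b ≤ a → c * aᶜ ≤ bᶜ := fun {a b} h => by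
      rw [IRL.fusion_law] at h ⊢
      rwa [compl_compl_eq, mul_comm]
    exact ⟨aux h.2, aux h.1⟩

theorem isRLCongruence_idempotentSetoid {A : Type u} [RL A] (c : A) (hc : c ≤ 1)
    (hcc : c * c = c) : IsRLCongruence (idempotentSetoid c hc hcc) where
  mul _ _ _ _ h h' := ⟨idempotentSetoid_mul hcc h.1 h'.1, idempotentSetoid_mul hcc h.2 h'.2⟩
  inf _ _ _ _ h h' :=
    ⟨le_inf ((mul_le_mul_right inf_le_left c).trans h.1)
      ((mul_le_mul_right inf_le_right c).trans h'.1),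
    le_inf ((mul_le_mul_right inf_le_left c).trans h.2)
      ((mul_le_mul_right inf_le_right c).trans h'.2)⟩
  sup _ _ _ _ h h' := by
    constructor <;> rw [RL.residuation] <;> refine sup_le ?_ ?_ <;> rw [← RL.residuation]
    exacts [h.1.trans le_sup_left, h'.1.trans le_sup_right, h.2.trans le_sup_left,
      h'.2.trans le_sup_right]
  himp _ _ _ _ h h' := by
    have aux : ∀ {a b z w : A}, c * b ≤ a → c * z ≤ w → c * (a ⇨ z) ≤ b ⇨ w :=
      fun {a b z w} h h' => by
        rw [← RL.residuation]
        calc b * (c * (a ⇨ z)) = c * ((c * b) * (a ⇨ z)) := by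
              conv_lhs => rw [← hcc]
              ac_rfl
          _ ≤ c * (a * (a ⇨ z)) := mul_le_mul_right (mul_le_mul_left h _) _
          _ ≤ c * z := mul_le_mul_right (mul_himp_le' _ _) _
          _ ≤ w := h'
    exact ⟨aux h.2 h'.1, aux h.1 h'.2⟩

/-- Finitely subdirectly irreducible Sugihara monoids are totally ordered. -/
theorem IsSugiharaMonoid.isChainAlgebra {A : Type u} [IRL A] (hA : IsSugiharaMonoid A)
    (hfsi : IsIRLFSI A) : IsChainAlgebra A := by
  have hid : ∀ x : A, x * x = x := fun x => by rw [← pow_two, hA.idempotent]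
  intro a b
  -- Prelinearity. After complementation, idempotence bounds the meet of a·¬b and b·¬a by their
  -- product, which regroups to at most f·f = f.
  have hsup : (1 : A) ≤ imp a b ⊔ imp b a := by
    rw [← compl_le_compl_iff', ← compl_compl_eq (imp a b), ← compl_compl_eq (imp b a),
      ← compl_inf', compl_compl_eq, imp, imp, compl_compl_eq, compl_compl_eq]
    calc (a * bᶜ) ⊓ (b * aᶜ) = ((a * bᶜ) ⊓ (b * aᶜ)) * ((a * bᶜ) ⊓ (b * aᶜ)) := (hid _).symm
      _ ≤ (a * bᶜ) * (b * aᶜ) := mul_le_mul' inf_le_left inf_le_right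
      _ = (a * aᶜ) * (b * bᶜ) := by ac_rfl
      _ ≤ f A * f A := mul_le_mul' (mul_compl_le_f a) (mul_compl_le_f b)
      _ = 1ᶜ := hid _
  have := hfsi _ _ (isIRLCongruence_idempotentSetoid (1 ⊓ imp a b) inf_le_left (hid _))
    (isIRLCongruence_idempotentSetoid (1 ⊓ imp b a) inf_le_left (hid _)) ?_
  · rcases this with h | h
    · left
      rw [← one_le_imp]
      exact inf_eq_left.1 (idempotentSetoid_eq_bot h)
    · right
      rw [← one_le_imp]
      exact inf_eq_left.1 (idempotentSetoid_eq_bot h)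
  · rw [← le_bot_iff]
    have aux : ∀ {x y : A}, (1 ⊓ imp a b) * x ≤ y → (1 ⊓ imp b a) * x ≤ y → x ≤ y := by
      intro x y h1 h2
      have h3 : (1 ⊓ imp a b) ⊔ (1 ⊓ imp b a) ≤ imp x y :=
        sup_le (by rwa [← mul_le_iff_le_imp, mul_comm]) (by rwa [← mul_le_iff_le_imp, mul_comm])
      rw [← hA.distrib, inf_eq_left.2 hsup, one_le_imp] at h3
      exact h3
    rintro x y ⟨h1, h2⟩
    exact le_antisymm (aux h1.1 h2.1) (aux h1.2 h2.2)

/-- Prelinearity read off componentwise: in each totally ordered factor one of the two multipliers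
becomes 1. Hence the congruences collapsing these multipliers to 1 meet in the identity. -/
theorem IsRLSemilinear.le_of_mul_le {A : Type u} [RL A] (hA : IsRLSemilinear A) (a b : A)
    {x y : A} (h1 : (1 ⊓ (a ⇨ b)) * x ≤ y) (h2 : (1 ⊓ (b ⇨ a)) * x ≤ y) : x ≤ y := by
  obtain ⟨I, B, _, p, hch, hp, -, hinj⟩ := hA
  have mono : ∀ i {u v : A}, u ≤ v → p i u ≤ p i v := fun i {u v} h => by
    rw [← inf_eq_left, ← (hp i).map_inf, inf_eq_left.2 h]
  rw [← inf_eq_left]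
  refine hinj _ _ fun i => ?_
  rw [(hp i).map_inf, inf_eq_left]
  have h1' := mono i h1
  have h2' := mono i h2
  simp only [(hp i).map_mul, (hp i).map_inf, (hp i).map_one, (hp i).map_himp] at h1' h2'
  rcases hch i (p i a) (p i b) with h | h
  · rwa [inf_eq_left.2 (one_le_himp.2 h), one_mul] at h1'
  · rwa [inf_eq_left.2 (one_le_himp.2 h), one_mul] at h2'

/-- Finitely subdirectly irreducible generalized Sugihara monoids are totally ordered. -/
theorem IsGeneralizedSugiharaMonoid.isChainAlgebra {A : Type u} [RL A]
    (hA : IsGeneralizedSugiharaMonoid A) (hfsi : IsRLFSI A) : IsChainAlgebra A := by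
  have hid : ∀ x : A, x * x = x := fun x => by rw [← pow_two, hA.idempotent]
  intro a b
  have := hfsi _ _ (isRLCongruence_idempotentSetoid (1 ⊓ (a ⇨ b)) inf_le_left (hid _))
    (isRLCongruence_idempotentSetoid (1 ⊓ (b ⇨ a)) inf_le_left (hid _)) ?_
  · rcases this with h | h
    · left
      rw [← one_le_himp]
      exact inf_eq_left.1 (idempotentSetoid_eq_bot h)
    · right
      rw [← one_le_himp]
      exact inf_eq_left.1 (idempotentSetoid_eq_bot h)
  · rw [← le_bot_iff]
    rintro x y ⟨h1, h2⟩
    exact le_antisymm (hA.semilinear.le_of_mul_le a b h1.1 h2.1)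
      (hA.semilinear.le_of_mul_le a b h1.2 h2.2)

end FSI

/-! ### Square-increasing chains and the interval [¬(f²), f²]. -/

section Chain

/-- The element `f²`. -/
def fSq (A : Type u) [IRL A] : A := f A * f A

/-- The totally ordered square-increasing IRLs in which `e < f`. -/
structure IsStrictChain (A : Type u) [IRL A] : Prop where
  chain : IsChainAlgebra A
  le_mul_self : ∀ x : A, x ≤ x * x
  one_lt_f : 1 < f A

variable {A : Type u} [IRL A]

theorem mul_self_of_le_one (hsq : ∀ x : A, x ≤ x * x) {x : A} (hx : x ≤ 1) : x * x = x :=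
  le_antisymm (mul_le_of_le_one_left' hx) (hsq x)

/-- A square-increasing IRL in which `f ≤ e` is idempotent. -/
theorem mul_self_of_f_le_one (hsq : ∀ x : A, x ≤ x * x) (hf : f A ≤ 1) (x : A) : x * x = x := by
  refine le_antisymm ?_ (hsq x)
  rw [le_iff_mul_compl_le_f]
  calc x * x * xᶜ ≤ x * x * (xᶜ * xᶜ) := mul_le_mul_right (hsq _) _
    _ = (x * xᶜ) * (x * xᶜ) := by ac_rfl
    _ ≤ f A * f A := mul_le_mul' (mul_compl_le_f x) (mul_compl_le_f x)
    _ ≤ f A := mul_le_of_le_one_left' hf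

theorem imp_mul_self (hsq : ∀ x : A, x ≤ x * x) {x y : A} (hx : x * x = x) (hy : y * y = y) :
    imp x y * imp x y = imp x y := by
  refine le_antisymm ?_ (hsq _)
  rw [← mul_le_iff_le_imp]
  calc x * (imp x y * imp x y) = (x * imp x y) * (x * imp x y) := by
        rw [mul_mul_mul_comm, hx]
    _ ≤ y * y := mul_le_mul' (mul_imp_le x y) (mul_imp_le x y)
    _ = y := hy

theorem star_mul_self (hsq : ∀ x : A, x ≤ x * x) {x : A} (hx : x * x = x) :
    star x * star x = star x := imp_mul_self hsq hx (mul_one 1)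

namespace IsStrictChain

variable (h : IsStrictChain A)
include h

theorem f_le_fSq : f A ≤ fSq A := h.le_mul_self _

theorem one_lt_fSq : 1 < fSq A := h.one_lt_f.trans_le h.f_le_fSq

theorem compl_fSq_lt_one : (fSq A)ᶜ < 1 := by
  rw [← compl_f, compl_lt_compl_iff']
  refine lt_of_le_not_ge h.f_le_fSq fun h1 => h.one_lt_f.not_ge ?_
  rwa [fSq, mul_le_f_iff, compl_f] at h1

theorem compl_fSq_lt_fSq : (fSq A)ᶜ < fSq A := h.compl_fSq_lt_one.trans h.one_lt_fSq

/-- Since f²·¬(f²) ≤ f, already f·¬(f²) ≤ e. As ¬(f²) is idempotent, f·¬(f²)·f² equals the square of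
f·¬(f²) times f, hence is at most f. -/
theorem f_mul_compl_fSq : f A * (fSq A)ᶜ = (fSq A)ᶜ := by
  have h1 : f A * (fSq A)ᶜ ≤ 1 := by
    rw [← compl_f, ← mul_le_f_iff, mul_comm, ← mul_assoc]
    exact mul_compl_le_f _
  refine le_antisymm ?_ (le_mul_of_one_le_left' h.one_lt_f.le)
  rw [← mul_le_f_iff]
  calc f A * (fSq A)ᶜ * fSq A = f A * ((fSq A)ᶜ * (fSq A)ᶜ) * (f A * f A) := by
        rw [mul_self_of_le_one h.le_mul_self h.compl_fSq_lt_one.le]; rfl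
    _ = (f A * (fSq A)ᶜ) * (f A * (fSq A)ᶜ) * f A := by ac_rfl
    _ ≤ 1 * 1 * f A := mul_le_mul_left (mul_le_mul' h1 h1) _
    _ = f A := by simp

theorem fSq_mul_compl_fSq : fSq A * (fSq A)ᶜ = (fSq A)ᶜ := by
  calc fSq A * (fSq A)ᶜ = f A * (f A * (fSq A)ᶜ) := mul_assoc ..
    _ = (fSq A)ᶜ := by rw [h.f_mul_compl_fSq, h.f_mul_compl_fSq]

theorem fSq_mul_f : fSq A * f A = fSq A := by
  refine le_antisymm ?_ (le_mul_of_one_le_right' h.one_lt_f.le)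
  rw [le_iff_mul_compl_le_f, mul_assoc, h.f_mul_compl_fSq, h.fSq_mul_compl_fSq]
  exact (h.compl_fSq_lt_one.trans h.one_lt_f).le

theorem fSq_mul_fSq : fSq A * fSq A = fSq A := by
  conv_lhs => rhs; rw [fSq]
  rw [← mul_assoc, h.fSq_mul_f, h.fSq_mul_f]

/-- In the case x ≤ e one has e ≤ x·f: otherwise x·f ≤ e, so x·f² ≤ f and x ≤ ¬(f²). Squaring e ≤
x·f and multiplying by f² gives the lower bound. -/
theorem mul_fSq {x : A} (hx : (fSq A)ᶜ < x) (hx' : x ≤ fSq A) : x * fSq A = fSq A := by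
  apply le_antisymm
  · exact (mul_le_mul_left hx' _).trans_eq h.fSq_mul_fSq
  rcases h.chain 1 x with h1 | h1
  · exact le_mul_of_one_le_left' h1
  · have h2 : 1 ≤ x * f A := by
      refine (h.chain _ _).resolve_right fun h3 => hx.not_ge ?_
      rwa [← mul_le_f_iff, fSq, ← mul_assoc, mul_le_f_iff, compl_f]
    calc fSq A = 1 * 1 * fSq A := by simp
      _ ≤ (x * f A) * (x * f A) * fSq A := mul_le_mul_left (mul_le_mul' h2 h2) _
      _ = (x * x) * (f A * f A) * fSq A := by ac_rfl
      _ = x * fSq A := by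
        rw [mul_self_of_le_one h.le_mul_self h1, ← fSq, mul_assoc, h.fSq_mul_fSq]

/-- The complement of x is negative, hence idempotent, so x²·¬x can be rewritten as (x·¬x)²·¬x ≤
f²·¬x ≤ x·¬x ≤ f. -/
theorem mul_self_of_fSq_le {x : A} (hx : fSq A ≤ x) : x * x = x := by
  have hn : xᶜ * xᶜ = xᶜ := mul_self_of_le_one h.le_mul_self
    ((compl_le_compl_iff'.2 hx).trans h.compl_fSq_lt_one.le)
  refine le_antisymm ?_ (h.le_mul_self x)
  rw [le_iff_mul_compl_le_f]
  calc x * x * xᶜ = (x * xᶜ) * (x * xᶜ) * xᶜ := by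
        rw [mul_mul_mul_comm, mul_assoc (x * x), hn, hn]
    _ ≤ f A * f A * xᶜ := mul_le_mul_left (mul_le_mul' (mul_compl_le_f x) (mul_compl_le_f x)) _
    _ ≤ x * xᶜ := mul_le_mul_left hx _
    _ ≤ f A := mul_compl_le_f x

theorem mul_fSq_of_fSq_le {x : A} (hx : fSq A ≤ x) : x * fSq A = x :=
  le_antisymm ((mul_le_mul_right hx x).trans_eq (h.mul_self_of_fSq_le hx))
    (le_mul_of_one_le_right' h.one_lt_fSq.le)

/-- The claim amounts to x·w ≤ f for w = x → f². Here w ≤ e, so x·w is idempotent; if it were above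
f it would be above f², hence equal to f². Then x·f² = f², whereas x·f² = x. -/
theorem mul_compl_fSq_of_fSq_lt {x : A} (hx : fSq A < x) : x * (fSq A)ᶜ = x := by
  refine le_antisymm (mul_le_of_le_one_right' h.compl_fSq_lt_one.le) ?_
  rw [le_iff_mul_compl_le_f]
  change x * imp x (fSq A) ≤ f A
  set w := imp x (fSq A)
  have hxw : x * w ≤ fSq A := mul_imp_le _ _
  have hw : w ≤ 1 := (h.chain _ _).resolve_right fun h1 =>
    hx.not_ge ((le_mul_of_one_le_right' h1).trans hxw)
  refine (h.chain _ _).resolve_right fun h1 => ?_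
  have hxx := h.mul_self_of_fSq_le hx.le
  have h2 : fSq A ≤ x * w := by
    calc f A * f A ≤ (x * w) * (x * w) := mul_le_mul' h1 h1
      _ = (x * x) * (w * w) := mul_mul_mul_comm ..
      _ = x * w := by rw [hxx, mul_self_of_le_one h.le_mul_self hw]
  have h3 : x * w = fSq A := le_antisymm hxw h2
  have h4 : x * fSq A = fSq A := by rw [← h3, ← mul_assoc, hxx]
  rw [h.mul_fSq_of_fSq_le hx.le] at h4
  exact hx.ne' h4

end IsStrictChain

/-- The elements outside the interval `[¬(f²), f²]`. -/
def outerSet (A : Type u) [IRL A] : Set A := {x | x < (fSq A)ᶜ ∨ fSq A < x}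

/-- The elements that form the lower part `D` of the reflection `[¬(f²), f²]` when `A` is negatively
generated. -/
def coreSet (A : Type u) [IRL A] : Set A :=
  {x | (fSq A)ᶜ < x ∧ (fSq A)ᶜ < star x ∧ (x ≤ 1 ∨ star (star x) = x)}

theorem compl_mem_outerSet {x : A} (hx : x ∈ outerSet A) : xᶜ ∈ outerSet A := by
  rcases hx with hx | hx
  · right
    rwa [← compl_lt_compl_iff', compl_compl_eq]
  · left
    rwa [compl_lt_compl_iff']

theorem star_star_of_mem_coreSet {x : A} (hx : x ∈ coreSet A) (h1 : 1 ≤ x) : star (star x) = x := by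
  rcases hx.2.2 with h2 | h2
  · rw [le_antisymm h2 h1]; simp
  · exact h2

theorem star_mem_coreSet {x : A} (h1 : (fSq A)ᶜ < x) (h2 : (fSq A)ᶜ < star x) :
    star x ∈ coreSet A :=
  ⟨h2, h1.trans_le (le_star_star x), Or.inr (star_star_star x)⟩

/-! ### Products, residuals and complements of outer and core elements. -/

namespace IsStrictChain

variable (h : IsStrictChain A)
include h

theorem outerSet_mul_self {x : A} (hx : x ∈ outerSet A) : x * x = x := by
  rcases hx with hx | hx
  · exact mul_self_of_le_one h.le_mul_self (hx.trans h.compl_fSq_lt_one).le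
  · exact h.mul_self_of_fSq_le hx.le

/-- Above the interval, x·¬(f²) = x = x·f² squeezes the product. Below it, x ≤ x·x ≤ x·y ≤ x·f², and
x·f² ≤ x because ¬x lies above f² and therefore absorbs f². -/
theorem outerSet_mul_inner {x y : A} (hx : x ∈ outerSet A) (hy : (fSq A)ᶜ ≤ y)
    (hy' : y ≤ fSq A) : x * y = x := by
  rcases hx with hx | hx
  · apply le_antisymm
    · refine (mul_le_mul_right hy' x).trans ?_
      rw [le_iff_mul_compl_le_f, mul_assoc, mul_comm (fSq A), h.mul_fSq_of_fSq_le]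
      · exact mul_compl_le_f x
      · rw [← compl_le_compl_iff', compl_compl_eq]
        exact hx.le
    · calc x ≤ x * x := h.le_mul_self x
        _ ≤ x * y := mul_le_mul_right (hx.le.trans hy) x
  · apply le_antisymm
    · exact (mul_le_mul_right hy' x).trans_eq (h.mul_fSq_of_fSq_le hx.le)
    · exact (h.mul_compl_fSq_of_fSq_lt hx).symm.le.trans (mul_le_mul_right hy x)

theorem mul_mem_outerSet {x y : A} (hx : x ∈ outerSet A) (hy : y ∈ outerSet A) :
    x * y ∈ outerSet A := by
  rcases mul_eq_left_or_right h.chain (h.outerSet_mul_self hx) (h.outerSet_mul_self hy) with h1 | h1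
  · rwa [h1]
  · rwa [h1]

theorem one_mem_coreSet : (1 : A) ∈ coreSet A :=
  ⟨h.compl_fSq_lt_one, by simpa using h.compl_fSq_lt_one, Or.inl le_rfl⟩

theorem coreSet_lt_fSq {x : A} (hx : x ∈ coreSet A) : x < fSq A := by
  refine h.chain.lt_of_not_le fun h1 => hx.2.1.not_ge ?_
  refine (star_anti h1).trans ?_
  rw [star_eq, h.fSq_mul_f]

theorem coreSet_mul_self {x : A} (hx : x ∈ coreSet A) : x * x = x := by
  rcases hx.2.2 with h1 | h1
  · exact mul_self_of_le_one h.le_mul_self h1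
  · rcases h.chain x 1 with h2 | h2
    · exact mul_self_of_le_one h.le_mul_self h2
    · rw [← h1]
      exact star_mul_self h.le_mul_self (mul_self_of_le_one h.le_mul_self (star_le_one h2))

theorem mem_coreSet_of_le_one {x : A} (h1 : (fSq A)ᶜ < x) (h2 : x ≤ 1) : x ∈ coreSet A :=
  ⟨h1, h.compl_fSq_lt_one.trans_le (one_le_star h2), Or.inl h2⟩

theorem inf_mem {s : Set A} {x y : A} (hx : x ∈ s) (hy : y ∈ s) : x ⊓ y ∈ s := by
  rcases h.chain x y with h1 | h1
  · rwa [inf_eq_left.2 h1]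
  · rwa [inf_eq_right.2 h1]

theorem sup_mem {s : Set A} {x y : A} (hx : x ∈ s) (hy : y ∈ s) : x ⊔ y ∈ s := by
  rcases h.chain x y with h1 | h1
  · rwa [sup_eq_right.2 h1]
  · rwa [sup_eq_left.2 h1]

theorem mul_mem_coreSet {x y : A} (hx : x ∈ coreSet A) (hy : y ∈ coreSet A) :
    x * y ∈ coreSet A := by
  rcases mul_eq_left_or_right h.chain (h.coreSet_mul_self hx) (h.coreSet_mul_self hy) with h1 | h1
  · rwa [h1]
  · rwa [h1]

theorem compl_fSq_lt_mul {x y : A} (hx : x * x = x) (hy : y * y = y) (h1 : (fSq A)ᶜ < x)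
    (h2 : (fSq A)ᶜ < y) : (fSq A)ᶜ < x * y := by
  rcases mul_eq_left_or_right h.chain hx hy with h3 | h3
  · rwa [h3]
  · rwa [h3]

theorem imp_eq_star {x y : A} (hx : x ≤ 1) (hy : y ≤ 1) (hxy : x ≤ y) : imp x y = star x := by
  apply le_antisymm
  · rw [le_star_iff]
    exact (mul_imp_le x y).trans hy
  · rw [← mul_le_iff_le_imp]
    refine le_trans ?_ hxy
    have hxx := mul_self_of_le_one h.le_mul_self hx
    rcases mul_eq_left_or_right h.chain hxx (star_mul_self h.le_mul_self hxx) with h1 | h1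
    · exact h1.le
    · have h2 : star x = 1 := le_antisymm (h1 ▸ mul_star_le x) (one_le_star hx)
      rw [h2, mul_one]

/-- Such a residual is either a star of an element, which satisfies the double-star condition
automatically, or negative. Only the lower bound ¬(f²) then needs proof. -/
theorem imp_mem_coreSet {x y : A} (hx : x ∈ coreSet A) (hy : y ∈ coreSet A) :
    imp x y ∈ coreSet A := by
  have hxx := h.coreSet_mul_self hx
  have hyy := h.coreSet_mul_self hy
  have hss := star_mul_self h.le_mul_self hxx
  have hz : (fSq A)ᶜ < imp x y := by
    -- The element (y ∧ e)·x* is a lower bound of x → y and a product of two idempotents above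
    -- ¬(f²), hence equal to one of them.
    refine (h.compl_fSq_lt_mul (x := y ⊓ 1) (y := star x)
      (mul_self_of_le_one h.le_mul_self inf_le_right) hss ?_ hx.2.1).trans_le ?_
    · exact h.inf_mem (s := Set.Ioi _) hy.1 h.compl_fSq_lt_one
    · rw [← mul_le_iff_le_imp]
      calc x * ((y ⊓ 1) * star x) = (y ⊓ 1) * (x * star x) := by ac_rfl
        _ ≤ y * 1 := mul_le_mul' inf_le_left (mul_star_le x)
        _ = y := mul_one y
  by_cases hxy : x ≤ y
  · rcases h.chain y 1 with h1 | h1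
    · rw [h.imp_eq_star (hxy.trans h1) h1 hxy] at hz ⊢
      exact star_mem_coreSet hx.1 hz
    · have h2 : imp x y = star (x * star y) := by
        conv_lhs => rw [← star_star_of_mem_coreSet hy h1]
        exact imp_imp ..
      have hsy := star_mul_self h.le_mul_self hyy
      rw [h2] at hz ⊢
      exact star_mem_coreSet (h.compl_fSq_lt_mul hxx hsy hx.1 hy.2.1) hz
  · refine h.mem_coreSet_of_le_one hz ((h.chain _ _).resolve_right fun h1 => hxy ?_)
    exact one_le_imp.1 h1

/-- If x ≤ e, then ¬x lies between f and f², and both have square f² or more, but not beyond f². If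
e ≤ x, then x = x** gives ¬x = x*·f, whose square x*·f² is f² since ¬(f²) < x* ≤ e. -/
theorem compl_mul_compl_self {x : A} (hx : x ∈ coreSet A) : xᶜ * xᶜ = fSq A := by
  rcases h.chain x 1 with h1 | h1
  · have h2 : f A ≤ xᶜ := compl_le_compl_iff'.2 h1
    apply le_antisymm
    · have h3 : xᶜ ≤ fSq A := by rw [compl_le_comm']; exact hx.1.le
      exact (mul_le_mul' h3 h3).trans_eq h.fSq_mul_fSq
    · exact mul_le_mul' h2 h2
  · have h2 : xᶜ = star x * f A := by
      conv_lhs => rw [← star_star_of_mem_coreSet hx h1]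
      rw [star_eq (star x), compl_compl_eq]
    have h3 := star_le_one h1
    rw [h2, mul_mul_mul_comm, mul_self_of_le_one h.le_mul_self h3]
    exact h.mul_fSq hx.2.1 (h3.trans h.one_lt_fSq.le)

theorem compl_mul_compl {x y : A} (hx : x ∈ coreSet A) (hy : y ∈ coreSet A) :
    xᶜ * yᶜ = fSq A := by
  wlog hxy : x ≤ y generalizing x y
  · rw [mul_comm]
    exact this hy hx ((h.chain x y).resolve_left hxy)
  have h1 : yᶜ ≤ xᶜ := compl_le_compl_iff'.2 hxy
  apply le_antisymm
  · rw [← h.compl_mul_compl_self hx]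
    exact mul_le_mul_right h1 _
  · rw [← h.compl_mul_compl_self hy]
    exact mul_le_mul_left h1 _

/-- If ¬y ≤ x, squaring gives f² ≤ x, which is impossible in the core. -/
theorem lt_compl {x y : A} (hx : x ∈ coreSet A) (hy : y ∈ coreSet A) : x < yᶜ := by
  refine h.chain.lt_of_not_le fun h1 => (h.coreSet_lt_fSq hx).not_ge ?_
  rw [← h.compl_mul_compl_self hy, ← h.coreSet_mul_self hx]
  exact mul_le_mul' h1 h1

theorem mul_compl_fSq {x : A} (hx : (fSq A)ᶜ ≤ x) (hx' : x ≤ fSq A) :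
    x * (fSq A)ᶜ = (fSq A)ᶜ := by
  apply le_antisymm
  · exact (mul_le_mul_left hx' _).trans_eq h.fSq_mul_compl_fSq
  · conv_lhs => rw [← mul_self_of_le_one h.le_mul_self h.compl_fSq_lt_one.le]
    exact mul_le_mul_left hx _

/-- A strict chain is exhausted by these elements when it is negatively generated. -/
theorem mem_of_isNegativelyGenerated (hneg : IsNegativelyGenerated A) (x : A) :
    x ∈ outerSet A ∨ x = (fSq A)ᶜ ∨ x ∈ coreSet A ∨ xᶜ ∈ coreSet A ∨ x = fSq A := by
  have key : ∀ x, x ∈ coreSet A → (fSq A)ᶜ < x ∧ x ≤ fSq A := fun x hx =>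
    ⟨hx.1, (h.coreSet_lt_fSq hx).le⟩
  have key' : ∀ x, xᶜ ∈ coreSet A → (fSq A)ᶜ < x ∧ x ≤ fSq A := fun x hx => by
    obtain ⟨h1, h2⟩ := hx.1, h.coreSet_lt_fSq hx
    rw [compl_lt_compl_iff'] at h1
    rw [← compl_lt_compl_iff', compl_compl_eq] at h2
    exact ⟨h2, h1.le⟩
  have hz := h.compl_fSq_lt_fSq.le
  -- The candidate universe of S[R(D)] inside A.
  let T : Set A := {x | x ∈ outerSet A ∨ x = (fSq A)ᶜ ∨ x ∈ coreSet A ∨ xᶜ ∈ coreSet A ∨ x = fSq A}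
  suffices hT : IsSubuniverse T ∧ {a : A | a ≤ 1} ⊆ T by
    have hx : x ∈ generated {a : A | a ≤ 1} := by rw [hneg]; trivial
    exact hx T hT
  have hin : ∀ x : A, x = (fSq A)ᶜ ∨ x ∈ coreSet A ∨ xᶜ ∈ coreSet A ∨ x = fSq A →
      (fSq A)ᶜ ≤ x ∧ x ≤ fSq A := by
    rintro x (rfl | hx | hx | rfl)
    exacts [⟨le_rfl, hz⟩, ⟨(key x hx).1.le, (key x hx).2⟩, ⟨(key' x hx).1.le, (key' x hx).2⟩,
      ⟨hz, le_rfl⟩]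
  refine ⟨⟨?_, ?_, fun x hx y hy => h.inf_mem hx hy, fun x hx y hy => h.sup_mem hx hy, ?_⟩, ?_⟩
  · exact Or.inr (Or.inr (Or.inl h.one_mem_coreSet))
  · have hright : ∀ x y : A, x = (fSq A)ᶜ ∨ x ∈ coreSet A ∨ xᶜ ∈ coreSet A ∨ x = fSq A →
        y = (fSq A)ᶜ ∨ y = fSq A → x * y ∈ T := by
      rintro x y hx (rfl | rfl)
      · rw [h.mul_compl_fSq (hin x hx).1 (hin x hx).2]
        exact Or.inr (Or.inl rfl)
      · rcases hx with rfl | hx | hx | rfl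
        · rw [mul_comm, h.fSq_mul_compl_fSq]
          exact Or.inr (Or.inl rfl)
        · rw [h.mul_fSq (key x hx).1 (key x hx).2]
          simp [T]
        · rw [h.mul_fSq (key' x hx).1 (key' x hx).2]
          simp [T]
        · rw [h.fSq_mul_fSq]
          simp [T]
    rintro x (hx | hx) y (hy | hy)
    · exact Or.inl (h.mul_mem_outerSet hx hy)
    · rw [h.outerSet_mul_inner hx (hin y hy).1 (hin y hy).2]
      exact Or.inl hx
    · rw [mul_comm, h.outerSet_mul_inner hy (hin x hx).1 (hin x hx).2]
      exact Or.inl hy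
    · have hx0 := hx
      have hy0 := hy
      rcases hx with hx | hx | hx | hx
      · rw [mul_comm]
        exact hright y x hy0 (Or.inl hx)
      rotate_left 2
      · rw [mul_comm]
        exact hright y x hy0 (Or.inr hx)
      all_goals rcases hy with hy | hy | hy | hy
      all_goals try first | exact hright x y hx0 (Or.inl hy) | exact hright x y hx0 (Or.inr hy)
      · exact Or.inr (Or.inr (Or.inl (h.mul_mem_coreSet hx hy)))
      · refine Or.inr (Or.inr (Or.inr (Or.inl ?_)))
        have := h.imp_mem_coreSet hx hy
        rwa [imp, compl_compl_eq] at this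
      · refine Or.inr (Or.inr (Or.inr (Or.inl ?_)))
        have := h.imp_mem_coreSet hy hx
        rwa [imp, compl_compl_eq, mul_comm] at this
      · have := h.compl_mul_compl hx hy
        rw [compl_compl_eq, compl_compl_eq] at this
        rw [this]
        simp [T]
  · rintro x (hx | rfl | hx | hx | rfl)
    · exact Or.inl (compl_mem_outerSet hx)
    · simp [T]
    · exact Or.inr (Or.inr (Or.inr (Or.inl (by rwa [compl_compl_eq]))))
    · exact Or.inr (Or.inr (Or.inl hx))
    · simp [T]
  · intro x hx
    rcases h.chain x (fSq A)ᶜ with h1 | h1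
    · rcases h1.lt_or_eq with h2 | h2
      · exact Or.inl (Or.inl h2)
      · exact Or.inr (Or.inl h2)
    · rcases h1.lt_or_eq with h2 | h2
      · exact Or.inr (Or.inr (Or.inl (h.mem_coreSet_of_le_one h2 hx)))
      · exact Or.inr (Or.inl h2.symm)

end IsStrictChain

end Chain

theorem compl_sup' {A : Type u} [IRL A] (x y : A) : (x ⊔ y)ᶜ = xᶜ ⊓ yᶜ := by
  rw [← compl_compl_eq (xᶜ ⊓ yᶜ), compl_inf', compl_compl_eq, compl_compl_eq]

theorem IsIRLHom.equiv_symm {A B : Type u} [Mul A] [One A] [Min A] [Max A] [Compl A]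
    [Mul B] [One B] [Min B] [Max B] [Compl B] {e : A ≃ B} (h : IsIRLHom e) :
    IsIRLHom e.symm where
  map_mul x y := e.injective (by simp [h.map_mul])
  map_inf x y := e.injective (by simp [h.map_inf])
  map_sup x y := e.injective (by simp [h.map_sup])
  map_compl x := e.injective (by simp [h.map_compl])
  map_one := e.injective (by simp [h.map_one])

/-- The outer elements together with the neutral element. -/
def outerUnit (A : Type u) [IRL A] : Set A := {x | x = 1 ∨ x ∈ outerSet A}

theorem notMem_outerSet {A : Type u} [IRL A] {x : A} (h1 : (fSq A)ᶜ ≤ x) (h2 : x ≤ fSq A) :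
    x ∉ outerSet A := by
  rintro (h3 | h3)
  · exact h1.not_gt h3
  · exact h2.not_gt h3

theorem compl_lt_fSq_of_mem_coreSet {A : Type u} [IRL A] {a : A} (ha : a ∈ coreSet A) :
    aᶜ < fSq A := by
  rw [← compl_lt_compl_iff', compl_compl_eq]
  exact ha.1

/-! ### The algebras S and D carried by the outer elements and the core. -/

namespace IsStrictChain

variable {A : Type u} [IRL A] (h : IsStrictChain A)
include h

theorem mul_mem_outerSet_of_mem_outerUnit {x y : A} (hx : x ∈ outerSet A)
    (hy : y ∈ outerUnit A) : x * y ∈ outerSet A := by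
  rcases hy with rfl | hy
  · rwa [mul_one]
  · exact h.mul_mem_outerSet hx hy

theorem mul_mem_outerUnit {x y : A} (hx : x ∈ outerUnit A) (hy : y ∈ outerUnit A) :
    x * y ∈ outerUnit A := by
  rcases hx with rfl | hx
  · rwa [one_mul]
  · exact Or.inr (h.mul_mem_outerSet_of_mem_outerUnit hx hy)

theorem one_notMem_outerSet : (1 : A) ∉ outerSet A :=
  notMem_outerSet h.compl_fSq_lt_one.le h.one_lt_fSq.le

/-- No outer element lies between e and f. This is why the fusion law survives when the complement
of the unit is changed from f to e. -/
theorem le_one_iff_le_f {x : A} (hx : x ∈ outerSet A) : x ≤ 1 ↔ x ≤ f A := by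
  refine ⟨fun h1 => h1.trans h.one_lt_f.le, fun h1 => ?_⟩
  rcases hx with hx | hx
  · exact (hx.trans h.compl_fSq_lt_one).le
  · exact absurd (h1.trans h.f_le_fSq) hx.not_ge

open Classical in
/-- The odd Sugihara monoid formed by the outer elements and the neutral element. -/
@[reducible] noncomputable def outerIRL : IRL (outerUnit A) where
  __ := Subtype.lattice (P := (· ∈ outerUnit A)) (fun _ _ hx hy => h.sup_mem hx hy)
    (fun _ _ hx hy => h.inf_mem hx hy)
  mul x y := ⟨x * y, h.mul_mem_outerUnit x.2 y.2⟩
  one := ⟨1, Or.inl rfl⟩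
  mul_assoc x y z := Subtype.ext (mul_assoc (x : A) y z)
  one_mul x := Subtype.ext (one_mul (x : A))
  mul_one x := Subtype.ext (mul_one (x : A))
  mul_comm x y := Subtype.ext (mul_comm (x : A) y)
  -- The complement f of e in A is not in this set, so the unit is made its own complement.
  compl x := ⟨if (x : A) = 1 then 1 else (x : A)ᶜ, by
    split_ifs with h1
    · exact Or.inl rfl
    · exact Or.inr (compl_mem_outerSet (x.2.resolve_left h1))⟩
  compl_compl' x := by
    apply Subtype.ext
    dsimp only
    split_ifs with h1 h2 h2
    · exact h1.symm
    · exact absurd rfl h2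
    · exact absurd (h2 ▸ compl_mem_outerSet (x.2.resolve_left h1)) h.one_notMem_outerSet
    · exact compl_compl_eq _
  fusion_law x y z := by
    obtain ⟨x, hx⟩ := x
    obtain ⟨y, hy⟩ := y
    obtain ⟨z, hz⟩ := z
    change x * y ≤ z ↔ (if z = 1 then 1 else zᶜ) * y ≤ (if x = 1 then 1 else xᶜ)
    split_ifs with h1 h2 h2
    · rw [h1, h2]
    · rw [h1, h.le_one_iff_le_f (h.mul_mem_outerSet_of_mem_outerUnit (hx.resolve_left h2) hy),
        IRL.fusion_law, compl_f]
    · rw [h.le_one_iff_le_f (h.mul_mem_outerSet_of_mem_outerUnit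
        (compl_mem_outerSet (hz.resolve_left h1)) hy), IRL.fusion_law, h2, f]
    · exact IRL.fusion_law x y z

/-- The generalized Sugihara monoid formed by the core. -/
@[reducible] def coreRL : RL (coreSet A) where
  __ := Subtype.lattice (P := (· ∈ coreSet A)) (fun _ _ hx hy => h.sup_mem hx hy)
    (fun _ _ hx hy => h.inf_mem hx hy)
  mul x y := ⟨x * y, h.mul_mem_coreSet x.2 y.2⟩
  one := ⟨1, h.one_mem_coreSet⟩
  mul_assoc x y z := Subtype.ext (mul_assoc (x : A) y z)
  one_mul x := Subtype.ext (one_mul (x : A))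
  mul_one x := Subtype.ext (mul_one (x : A))
  mul_comm x y := Subtype.ext (mul_comm (x : A) y)
  himp x y := ⟨imp x y, h.imp_mem_coreSet x.2 y.2⟩
  residuation _ _ _ := mul_le_iff_le_imp (A := A)

theorem isChainAlgebra_outerUnit : letI := h.outerIRL; IsChainAlgebra (outerUnit A) :=
  fun x y => h.chain (x : A) y

open Classical in
theorem isOddSugiharaMonoid_outerUnit :
    letI := h.outerIRL; IsOddSugiharaMonoid (outerUnit A) := by
  let _ := h.outerIRL
  have hid : ∀ x : outerUnit A, x ^ 2 = x := fun x => by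
    rw [pow_two]
    apply Subtype.ext
    change (x : A) * x = x
    rcases x.2 with hx | hx
    · rw [hx, mul_one]
    · exact h.outerSet_mul_self hx
  refine ⟨⟨⟨fun x y z => ?_, fun x => (hid x).ge⟩, hid⟩, ?_⟩
  · rcases h.isChainAlgebra_outerUnit y z with h1 | h1
    · rw [sup_eq_right.2 h1, sup_eq_right.2 (inf_le_inf_left x h1)]
    · rw [sup_eq_left.2 h1, sup_eq_left.2 (inf_le_inf_left x h1)]
  · apply Subtype.ext
    change (if (1 : A) = 1 then (1 : A) else _) = 1
    simp

theorem isChainAlgebra_coreSet : letI := h.coreRL; IsChainAlgebra (coreSet A) :=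
  fun x y => h.chain (x : A) y

theorem isGeneralizedSugiharaMonoid_coreSet :
    letI := h.coreRL; IsGeneralizedSugiharaMonoid (coreSet A) := by
  let _ := h.coreRL
  refine ⟨⟨PUnit, fun _ => coreSet A, fun _ => inferInstance, fun _ => id,
    fun _ => h.isChainAlgebra_coreSet, fun _ => ⟨fun _ _ => rfl, fun _ _ => rfl, fun _ _ => rfl,
      fun _ _ => rfl, rfl⟩, fun _ => Function.surjective_id, fun a b hab => hab PUnit.unit⟩, ?_, ?_⟩
  · intro x
    rw [pow_two]
    exact Subtype.ext (h.coreSet_mul_self x.2)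
  · intro x
    apply Subtype.ext
    exact star_star_of_mem_coreSet (x ⊔ 1).2 (le_sup_right (a := (x : A)))

end IsStrictChain

/-- The embedding of the reflection of the core. -/
def reflectionVal {A : Type u} [IRL A] : Reflection (coreSet A) → A
  | .bot => (fSq A)ᶜ
  | .low a => a
  | .high a => (a : A)ᶜ
  | .top => fSq A

theorem reflectionVal_compl {A : Type u} [IRL A] (a : Reflection (coreSet A)) :
    reflectionVal aᶜ = (reflectionVal a)ᶜ := by
  rcases a with _ | a | a | _
  · exact (compl_compl_eq _).symm
  · rfl
  · exact (compl_compl_eq _).symm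
  · rfl

/-- The map from `S[R(D)]` to `A` for the outer elements `S` and the core `D` of `A`. -/
def rigorousVal {A : Type u} [IRL A] [One (outerUnit A)] :
    RigorousExtension (outerUnit A) (Reflection (coreSet A)) → A
  | .outer s _ => s
  | .inner a => reflectionVal a

/-! ### The isomorphism between S[R(D)] and a negatively generated strict chain. -/

namespace IsStrictChain

variable {A : Type u} [IRL A] (h : IsStrictChain A)
include h

theorem compl_fSq_lt_compl {a : A} (ha : a ∈ coreSet A) : (fSq A)ᶜ < aᶜ :=
  compl_lt_compl_iff'.2 (h.coreSet_lt_fSq ha)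

theorem compl_fSq_le_reflectionVal (a : Reflection (coreSet A)) : (fSq A)ᶜ ≤ reflectionVal a := by
  rcases a with _ | a | a | _
  exacts [le_rfl, a.2.1.le, (h.compl_fSq_lt_compl a.2).le, h.compl_fSq_lt_fSq.le]

theorem reflectionVal_le_fSq (a : Reflection (coreSet A)) : reflectionVal a ≤ fSq A := by
  rcases a with _ | a | a | _
  exacts [h.compl_fSq_lt_fSq.le, (h.coreSet_lt_fSq a.2).le, (compl_lt_fSq_of_mem_coreSet a.2).le,
    le_rfl]

theorem reflectionVal_injective :
    Function.Injective (reflectionVal : Reflection (coreSet A) → A) := by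
  rintro (_ | a | a | _) (_ | b | b | _) hab
  · rfl
  · exact absurd hab b.2.1.ne
  · exact absurd hab (h.compl_fSq_lt_compl b.2).ne
  · exact absurd hab h.compl_fSq_lt_fSq.ne
  · exact absurd hab a.2.1.ne'
  · exact congrArg _ (Subtype.ext hab)
  · exact absurd hab (h.lt_compl a.2 b.2).ne
  · exact absurd hab (h.coreSet_lt_fSq a.2).ne
  · exact absurd hab (h.compl_fSq_lt_compl a.2).ne'
  · exact absurd hab (h.lt_compl b.2 a.2).ne'
  · exact congrArg _ (Subtype.ext (compl_injective' hab))
  · exact absurd hab (compl_lt_fSq_of_mem_coreSet a.2).ne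
  · exact absurd hab h.compl_fSq_lt_fSq.ne'
  · exact absurd hab (h.coreSet_lt_fSq b.2).ne'
  · exact absurd hab (compl_lt_fSq_of_mem_coreSet b.2).ne'
  · rfl

theorem reflectionVal_mul (a b : Reflection (coreSet A)) :
    letI := h.coreRL; reflectionVal (a * b) = reflectionVal a * reflectionVal b := by
  let _ := h.coreRL
  have hz : ∀ a : Reflection (coreSet A), reflectionVal a * (fSq A)ᶜ = (fSq A)ᶜ := fun a =>
    h.mul_compl_fSq (h.compl_fSq_le_reflectionVal a) (h.reflectionVal_le_fSq a)
  have ht : ∀ a : A, a ∈ coreSet A → a * fSq A = fSq A := fun a ha =>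
    h.mul_fSq ha.1 (h.coreSet_lt_fSq ha).le
  have ht' : ∀ a : A, a ∈ coreSet A → aᶜ * fSq A = fSq A := fun a ha =>
    h.mul_fSq (h.compl_fSq_lt_compl ha) (compl_lt_fSq_of_mem_coreSet ha).le
  rcases a with _ | a | a | _ <;> rcases b with _ | b | b | _
  · exact (hz .bot).symm
  · exact ((mul_comm ..).trans (hz (.low b))).symm
  · exact ((mul_comm ..).trans (hz (.high b))).symm
  · exact ((mul_comm ..).trans (hz .top)).symm
  · exact (hz (.low a)).symm
  · rfl
  · exact compl_compl_eq _
  · exact (ht a a.2).symm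
  · exact (hz (.high a)).symm
  · exact (compl_compl_eq _).trans (mul_comm ..)
  · exact (h.compl_mul_compl a.2 b.2).symm
  · exact (ht' a a.2).symm
  · exact (hz .top).symm
  · exact ((mul_comm ..).trans (ht b b.2)).symm
  · exact ((mul_comm ..).trans (ht' b b.2)).symm
  · exact h.fSq_mul_fSq.symm

theorem reflectionVal_inf (a b : Reflection (coreSet A)) :
    letI := h.coreRL; reflectionVal (a ⊓ b) = reflectionVal a ⊓ reflectionVal b := by
  let _ := h.coreRL
  have hz := h.compl_fSq_le_reflectionVal
  have ht := h.reflectionVal_le_fSq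
  rcases a with _ | a | a | _ <;> rcases b with _ | b | b | _
  · exact (inf_eq_left.2 (hz _)).symm
  · exact (inf_eq_left.2 (hz (.low b))).symm
  · exact (inf_eq_left.2 (hz (.high b))).symm
  · exact (inf_eq_left.2 (hz .top)).symm
  · exact (inf_eq_right.2 (hz (.low a))).symm
  · rfl
  · exact (inf_eq_left.2 (h.lt_compl a.2 b.2).le).symm
  · exact (inf_eq_left.2 (ht (.low a))).symm
  · exact (inf_eq_right.2 (hz (.high a))).symm
  · exact (inf_eq_right.2 (h.lt_compl b.2 a.2).le).symm
  · exact compl_sup' (a : A) b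
  · exact (inf_eq_left.2 (ht (.high a))).symm
  · exact (inf_eq_right.2 (hz .top)).symm
  · exact (inf_eq_right.2 (ht (.low b))).symm
  · exact (inf_eq_right.2 (ht (.high b))).symm
  · exact (inf_eq_right.2 (ht .top)).symm

theorem reflectionVal_sup (a b : Reflection (coreSet A)) :
    letI := h.coreRL; reflectionVal (a ⊔ b) = reflectionVal a ⊔ reflectionVal b := by
  let _ := h.coreRL
  have hz := h.compl_fSq_le_reflectionVal
  have ht := h.reflectionVal_le_fSq
  rcases a with _ | a | a | _ <;> rcases b with _ | b | b | _
  · exact (sup_eq_right.2 (hz .bot)).symm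
  · exact (sup_eq_right.2 (hz (.low b))).symm
  · exact (sup_eq_right.2 (hz (.high b))).symm
  · exact (sup_eq_right.2 (hz .top)).symm
  · exact (sup_eq_left.2 (hz (.low a))).symm
  · rfl
  · exact (sup_eq_right.2 (h.lt_compl a.2 b.2).le).symm
  · exact (sup_eq_right.2 (ht (.low a))).symm
  · exact (sup_eq_left.2 (hz (.high a))).symm
  · exact (sup_eq_left.2 (h.lt_compl b.2 a.2).le).symm
  · exact compl_inf' (a : A) b
  · exact (sup_eq_right.2 (ht (.high a))).symm
  · exact (sup_eq_left.2 (hz .top)).symm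
  · exact (sup_eq_left.2 (ht (.low b))).symm
  · exact (sup_eq_left.2 (ht (.high b))).symm
  · exact (sup_eq_left.2 (ht .top)).symm

/-- Treats product, meet and join at once. The hypothesis `hin` says that an inner element meets an
outer one exactly as e does, which is what the mixed clauses of the rigorous extension prescribe. -/
theorem rigorousVal_extend (op : A → A → A) (hcomm : ∀ x y, op x y = op y x)
    (opS : outerUnit A → outerUnit A → outerUnit A) (hS : ∀ s p, (opS s p : A) = op s p)
    (opR : Reflection (coreSet A) → Reflection (coreSet A) → Reflection (coreSet A))
    (hR : ∀ a b, reflectionVal (opR a b) = op (reflectionVal a) (reflectionVal b))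
    (hO : ∀ x ∈ outerSet A, ∀ y ∈ outerSet A, op x y ∈ outerSet A)
    (hin : ∀ x : A, (fSq A)ᶜ ≤ x → x ≤ fSq A → ∀ s ∈ outerSet A,
      op 1 s = 1 ∧ op x s = x ∨ op 1 s = s ∧ op x s = s) :
    letI := h.outerIRL; letI := h.coreRL;
    ∀ x y, rigorousVal (RigorousExtension.extend opS opR x y)
      = op (rigorousVal x) (rigorousVal y) := by
  let _ := h.outerIRL
  let _ := h.coreRL
  have hne : ∀ s : outerUnit A, s ≠ 1 → (s : A) ∈ outerSet A := fun s hs =>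
    s.2.resolve_left fun h1 => hs (Subtype.ext h1)
  have hmix : ∀ (s : outerUnit A) (hs : s ≠ 1) (a : Reflection (coreSet A)),
      rigorousVal (RigorousExtension.extend opS opR (.inner a) (.outer s hs)) =
        op (reflectionVal a) s := by
    intro s hs a
    rcases hin _ (h.compl_fSq_le_reflectionVal a) (h.reflectionVal_le_fSq a) s (hne s hs) with
      ⟨h1, h2⟩ | ⟨h1, h2⟩
    · have h3 : opS 1 s = 1 := Subtype.ext ((hS 1 s).trans h1)
      exact (congrArg rigorousVal (dif_pos h3)).trans h2.symm
    · have h3 : opS 1 s = s := Subtype.ext ((hS 1 s).trans h1)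
      exact (congrArg rigorousVal (dif_neg (by rwa [h3]))).trans
        ((congrArg Subtype.val h3).trans h2.symm)
  rintro (⟨s, hs⟩ | a) (⟨p, hp⟩ | b)
  · have h1 : opS s p ≠ 1 := fun h1 => by
      have h2 := hO _ (hne s hs) _ (hne p hp)
      rw [← hS, h1] at h2
      exact h.one_notMem_outerSet h2
    exact (congrArg rigorousVal (dif_neg h1)).trans (hS s p)
  · exact (hmix s hs b).trans (hcomm ..)
  · exact hmix p hp a
  · exact hR a b

theorem inf_outerSet_cases (x : A) (hx : (fSq A)ᶜ ≤ x) (hx' : x ≤ fSq A) (s : A)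
    (hs : s ∈ outerSet A) : x < s ∧ (1 : A) < s ∨ s < x ∧ s < 1 := by
  rcases hs with hs | hs
  · exact Or.inr ⟨hs.trans_le hx, hs.trans h.compl_fSq_lt_one⟩
  · exact Or.inl ⟨hx'.trans_lt hs, h.one_lt_fSq.trans hs⟩

theorem isIRLHom_rigorousVal :
    letI := h.outerIRL; letI := h.coreRL;
    IsIRLHom (rigorousVal : RigorousExtension (outerUnit A) (Reflection (coreSet A)) → A) := by
  let _ := h.outerIRL
  let _ := h.coreRL
  refine ⟨?_, ?_, ?_, ?_, rfl⟩
  · refine h.rigorousVal_extend (· * ·) mul_comm _ (fun _ _ => rfl) _ h.reflectionVal_mul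
      (fun x hx y hy => h.mul_mem_outerSet hx hy) fun x hx hx' s hs => Or.inr ⟨one_mul s, ?_⟩
    exact (mul_comm ..).trans (h.outerSet_mul_inner hs hx hx')
  · refine h.rigorousVal_extend (· ⊓ ·) inf_comm _ (fun _ _ => rfl) _ h.reflectionVal_inf
      (fun x hx y hy => h.inf_mem hx hy) fun x hx hx' s hs => ?_
    rcases h.inf_outerSet_cases x hx hx' s hs with h1 | h1
    · exact Or.inl ⟨inf_eq_left.2 h1.2.le, inf_eq_left.2 h1.1.le⟩
    · exact Or.inr ⟨inf_eq_right.2 h1.2.le, inf_eq_right.2 h1.1.le⟩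
  · refine h.rigorousVal_extend (· ⊔ ·) sup_comm _ (fun _ _ => rfl) _ h.reflectionVal_sup
      (fun x hx y hy => h.sup_mem hx hy) fun x hx hx' s hs => ?_
    rcases h.inf_outerSet_cases x hx hx' s hs with h1 | h1
    · exact Or.inr ⟨sup_eq_right.2 h1.2.le, sup_eq_right.2 h1.1.le⟩
    · exact Or.inl ⟨sup_eq_left.2 h1.2.le, sup_eq_left.2 h1.1.le⟩
  · rintro (⟨s, hs⟩ | a)
    · have hs' : (s : A) ≠ 1 := fun h1 => hs (Subtype.ext h1)
      have h1 : (sᶜ : outerUnit A) = (s : A)ᶜ := if_neg hs'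
      have h2 : sᶜ ≠ 1 := fun h2 => by
        have h3 := compl_mem_outerSet (s.2.resolve_left hs')
        rw [← h1, h2] at h3
        exact h.one_notMem_outerSet h3
      exact (congrArg rigorousVal (dif_neg h2)).trans h1
    · exact reflectionVal_compl a

theorem bijective_rigorousVal (hneg : IsNegativelyGenerated A) :
    letI := h.outerIRL;
    Function.Bijective
      (rigorousVal : RigorousExtension (outerUnit A) (Reflection (coreSet A)) → A) := by
  let _ := h.outerIRL
  have hdisj : ∀ (s : outerUnit A), s ≠ 1 → ∀ a : Reflection (coreSet A),
      (s : A) ≠ reflectionVal a := fun s hs a hsa => by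
    refine notMem_outerSet (h.compl_fSq_le_reflectionVal a) (h.reflectionVal_le_fSq a) ?_
    rw [← hsa]
    exact s.2.resolve_left fun h1 => hs (Subtype.ext h1)
  constructor
  · rintro (⟨s, hs⟩ | a) (⟨p, hp⟩ | b) hab
    · obtain rfl : s = p := Subtype.ext hab
      rfl
    · exact absurd hab (hdisj s hs b)
    · exact absurd hab.symm (hdisj p hp a)
    · exact congrArg _ (h.reflectionVal_injective hab)
  · intro x
    rcases h.mem_of_isNegativelyGenerated hneg x with hx | rfl | hx | hx | rfl
    · refine ⟨.outer ⟨x, Or.inr hx⟩ fun h1 => ?_, rfl⟩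
      have h2 : x = 1 := congrArg Subtype.val h1
      exact h.one_notMem_outerSet (h2 ▸ hx)
    · exact ⟨.inner .bot, rfl⟩
    · exact ⟨.inner (.low ⟨x, hx⟩), rfl⟩
    · exact ⟨.inner (.high ⟨xᶜ, hx⟩), compl_compl_eq x⟩
    · exact ⟨.inner .top, rfl⟩

theorem isRigorousReflection (hneg : IsNegativelyGenerated A) : IsRigorousReflection A := by
  let _ := h.outerIRL
  let _ := h.coreRL
  let e := Equiv.ofBijective _ (h.bijective_rigorousVal hneg)
  exact ⟨outerUnit A, coreSet A, h.outerIRL, h.coreRL, h.isOddSugiharaMonoid_outerUnit,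
    h.isChainAlgebra_outerUnit.isIRLFSI, h.isGeneralizedSugiharaMonoid_coreSet,
    h.isChainAlgebra_coreSet.isRLFSI, e.symm, IsIRLHom.equiv_symm h.isIRLHom_rigorousVal,
    e.symm.bijective⟩

end IsStrictChain

/-- A negatively generated De Morgan chain is a Sugihara monoid or of the form `S[R(D)]`. -/
theorem IsDeMorganMonoid.isSugiharaChainOrRigorousReflection {B : Type u} [IRL B]
    (hB : IsDeMorganMonoid B) (hch : IsChainAlgebra B) (hneg : IsNegativelyGenerated B) :
    IsSugiharaChainOrRigorousReflection B := by
  have hsq : ∀ x : B, x ≤ x * x := fun x => by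
    rw [← pow_two]
    exact hB.square_increasing x
  by_cases hf : f B ≤ 1
  · exact Or.inl ⟨⟨hB, fun x => by rw [pow_two, mul_self_of_f_le_one hsq hf]⟩, hch⟩
  · exact Or.inr (IsStrictChain.isRigorousReflection ⟨hch, hsq, hch.lt_of_not_le hf⟩ hneg)

/-! ### Transfer along surjections and subdirect representations. -/

section Subdirect

variable {A B : Type u} [IRL A] [IRL B] {p : A → B}

theorem IsSubuniverse.preimage (hp : IsIRLHom p) {T : Set B} (hT : IsSubuniverse T) :
    IsSubuniverse (p ⁻¹' T) where
  one_mem := by simpa [hp.map_one] using hT.one_mem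
  mul_mem x hx y hy := by simpa [hp.map_mul] using hT.mul_mem _ hx _ hy
  inf_mem x hx y hy := by simpa [hp.map_inf] using hT.inf_mem _ hx _ hy
  sup_mem x hx y hy := by simpa [hp.map_sup] using hT.sup_mem _ hx _ hy
  compl_mem x hx := by simpa [hp.map_compl] using hT.compl_mem _ hx

theorem IsIRLHom.mono (hp : IsIRLHom p) {x y : A} (h : x ≤ y) : p x ≤ p y := by
  rw [← inf_eq_left, ← hp.map_inf, inf_eq_left.2 h]

theorem IsNegativelyGenerated.of_surjective (hA : IsNegativelyGenerated A) (hp : IsIRLHom p)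
    (hsurj : Function.Surjective p) : IsNegativelyGenerated B := by
  refine Set.eq_univ_of_forall fun b => ?_
  obtain ⟨a, rfl⟩ := hsurj b
  rintro T ⟨hT, hsub⟩
  have ha : a ∈ generated {a : A | a ≤ 1} := by rw [hA]; trivial
  refine ha (p ⁻¹' T) ⟨hT.preimage hp, fun x hx => hsub ?_⟩
  have := hp.mono (show x ≤ 1 from hx)
  rwa [hp.map_one] at this

theorem IsDeMorganMonoid.of_surjective (hA : IsDeMorganMonoid A) (hp : IsIRLHom p)
    (hsurj : Function.Surjective p) : IsDeMorganMonoid B where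
  distrib x y z := by
    obtain ⟨x, rfl⟩ := hsurj x
    obtain ⟨y, rfl⟩ := hsurj y
    obtain ⟨z, rfl⟩ := hsurj z
    simp only [← hp.map_inf, ← hp.map_sup, hA.distrib]
  square_increasing x := by
    obtain ⟨x, rfl⟩ := hsurj x
    have := hp.mono (hA.square_increasing x)
    rwa [pow_two, hp.map_mul, ← pow_two] at this

theorem IsIRLHom.map_imp (hp : IsIRLHom p) (x y : A) : p (imp x y) = imp (p x) (p y) := by
  simp [imp, hp.map_mul, hp.map_compl]

theorem IsIRLHom.map_f (hp : IsIRLHom p) : p (f A) = f B := by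
  simp [f, hp.map_one, hp.map_compl]

theorem IsIRLHom.map_sigma (hp : IsIRLHom p) (x : A) : p (sigma x) = sigma (p x) := by
  simp [sigma, star, hp.map_imp, hp.map_one, hp.map_inf, hp.map_mul]

theorem IsIRLHom.map_d' (hp : IsIRLHom p) (x : A) : p (d' x) = d' (p x) := by
  simp [d', pow_two, hp.map_imp, hp.map_inf, hp.map_mul, hp.map_f, hp.map_compl]

theorem SatisfiesNegcone.of_forall {I : Type u} {B : I → Type u} [∀ i, IRL (B i)]
    {p : ∀ i, A → B i} (hp : ∀ i, IsIRLHom (p i)) (hinj : ∀ a b : A, (∀ i, p i a = p i b) → a = b)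
    (hB : ∀ i, SatisfiesNegcone (B i)) : SatisfiesNegcone A := by
  intro x
  refine hinj _ _ fun i => ?_
  have := hB i (p i x)
  simpa only [d, sigma', pow_two, (hp i).map_imp, (hp i).map_inf, (hp i).map_sup, (hp i).map_mul,
    (hp i).map_f, (hp i).map_compl, (hp i).map_sigma, (hp i).map_d'] using this

end Subdirect

/-! ### The equation implies negative generation. -/

section NegativeGeneration

variable {A : Type u} [IRL A]

theorem isSubuniverse_generated (X : Set A) : IsSubuniverse (generated X) where
  one_mem _ hT := hT.1.one_mem
  mul_mem _ hx _ hy T hT := hT.1.mul_mem _ (hx T hT) _ (hy T hT)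
  inf_mem _ hx _ hy T hT := hT.1.inf_mem _ (hx T hT) _ (hy T hT)
  sup_mem _ hx _ hy T hT := hT.1.sup_mem _ (hx T hT) _ (hy T hT)
  compl_mem _ hx T hT := hT.1.compl_mem _ (hx T hT)

theorem SatisfiesNegcone.isNegativelyGenerated (hA : SatisfiesNegcone A) :
    IsNegativelyGenerated A := by
  have hG := isSubuniverse_generated {a : A | a ≤ 1}
  set G := generated {a : A | a ≤ 1} with hGdef
  have hneg : ∀ a : A, a ≤ 1 → a ∈ G := fun a ha T hT => hT.2 ha
  have himp : ∀ x ∈ G, ∀ y ∈ G, imp x y ∈ G := fun x hx y hy =>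
    hG.compl_mem _ (hG.mul_mem _ hx _ (hG.compl_mem _ hy))
  have hf : f A ∈ G := hG.compl_mem _ hG.one_mem
  have hff : f A ^ 2 ∈ G := by rw [pow_two]; exact hG.mul_mem _ hf _ hf
  -- Here x is arbitrary: it enters σ only through x ∧ e and x* ∧ e, which are negative.
  have hsigma : ∀ x : A, sigma x ∈ G := fun x =>
    hG.mul_mem _ (hneg _ inf_le_right) _ (himp _ (hneg _ inf_le_right) _ hG.one_mem)
  have hsigma' : ∀ x : A, sigma' x ∈ G := fun x => hG.compl_mem _ (hsigma _)
  have hd' : ∀ x ∈ G, d' x ∈ G := fun x hx =>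
    hG.inf_mem _ (himp _ hff _ (hG.mul_mem _ hx _ hf)) _
      (hG.mul_mem _ hff _ (hG.compl_mem _ hx))
  refine Set.eq_univ_of_forall fun x => ?_
  change x ∈ G
  rw [hA x]
  exact hG.sup_mem _ (hG.sup_mem _
    (hG.inf_mem _ (hd' _ (hG.compl_mem _ (hsigma x))) _ (hsigma x)) _
    (hG.inf_mem _ (hd' _ (hsigma' x)) _ (hsigma' x))) _
    (himp _ (hG.sup_mem _ hff _ (hG.compl_mem _ hff)) _ (hsigma' x))

end NegativeGeneration

/-! ### Validity of the equation in Sugihara chains and in S[R(D)]. -/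

section Equation

theorem imp_one_left {A : Type u} [IRL A] (x : A) : imp 1 x = x := by simp [imp]

theorem IsSugiharaMonoid.f_le_one {A : Type u} [IRL A] (hA : IsSugiharaMonoid A) : f A ≤ 1 := by
  have h := hA.idempotent (f A)
  rw [pow_two] at h
  have h1 := mul_le_f_iff.1 h.le
  rwa [compl_f] at h1

/-- For x > e the term reduces to x**. The product x·f is x or f, and f would force x ≤ ¬f = e; so
x* = ¬x, and ¬x = ¬x·¬x ≤ ¬x·f gives x** ≤ x. -/
theorem IsSugiharaMonoid.sigma_eq {A : Type u} [IRL A] (hA : IsSugiharaMonoid A)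
    (hch : IsChainAlgebra A) (x : A) : sigma x = x := by
  have hid : ∀ x : A, x * x = x := fun x => by rw [← pow_two, hA.idempotent]
  have hf := hA.f_le_one
  by_cases hx : x ≤ 1
  · rw [sigma, inf_eq_left.2 hx, inf_eq_right.2 (one_le_star hx), star_one, mul_one]
  · have hx' := (hch.lt_of_not_le hx).le
    rw [sigma, inf_eq_right.2 hx', inf_eq_left.2 (star_le_one hx'), one_mul]
    refine le_antisymm ?_ (le_star_star x)
    have h1 : x * f A = x := by
      rcases mul_eq_left_or_right hch (hid x) (hid (f A)) with h | h
      · exact h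
      · exact absurd (by simpa using mul_le_f_iff.1 h.le) hx
    rw [star_eq x, h1, star_eq, compl_le_comm']
    calc xᶜ = xᶜ * xᶜ := (hid _).symm
      _ ≤ xᶜ * f A := mul_le_mul_right (compl_le_compl_iff'.2 hx') _

theorem IsSugiharaMonoid.satisfiesNegcone {A : Type u} [IRL A] (hA : IsSugiharaMonoid A)
    (hch : IsChainAlgebra A) : SatisfiesNegcone A := by
  intro x
  -- Since f² = f ≤ e, the antecedent f² ∨ ¬(f²) is e and the last joinand is x; the other two are
  -- below x.
  rw [sigma', hA.sigma_eq hch, hA.sigma_eq hch, compl_compl_eq, hA.idempotent, compl_f,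
    sup_eq_right.2 hA.f_le_one, imp_one_left]
  exact (sup_eq_right.2 (sup_le inf_le_right inf_le_right)).symm

namespace RigorousExtension

variable {S R : Type u} [IRL S] [One R]

theorem extend_outer_outer (opS : S → S → S) (opR : R → R → R) {s p q : S} (hs : s ≠ 1)
    (hp : p ≠ 1) (hq : q ≠ 1) (h : opS s p = q) :
    extend opS opR (outer s hs) (outer p hp) = outer q hq := by
  subst h
  exact dif_neg hq

theorem extend_outer_inner (opS : S → S → S) (opR : R → R → R) {s : S} (hs : s ≠ 1) (a : R)
    (h : opS 1 s = s) : extend opS opR (outer s hs) (inner a) = outer s hs :=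
  (dif_neg (by rwa [h])).trans (by simp only [h])

theorem outer_mul_inner [Mul R] (s : S) (hs : s ≠ 1) (a : R) :
    (outer s hs : RigorousExtension S R) * inner a = outer s hs :=
  extend_outer_inner _ _ hs a (one_mul s)

theorem inner_mul_outer [Mul R] (s : S) (hs : s ≠ 1) (a : R) :
    inner a * (outer s hs : RigorousExtension S R) = outer s hs :=
  outer_mul_inner s hs a

theorem outer_inf_inner_of_le [Min R] {s : S} (hs : s ≠ 1) (h : s ≤ 1) (a : R) :
    (outer s hs : RigorousExtension S R) ⊓ inner a = outer s hs :=
  extend_outer_inner _ _ hs a (inf_eq_right.2 h)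

theorem outer_inf_inner_of_ge [Min R] {s : S} (hs : s ≠ 1) (h : 1 ≤ s) (a : R) :
    (outer s hs : RigorousExtension S R) ⊓ inner a = inner a :=
  dif_pos (inf_eq_left.2 h)

theorem outer_inf_outer_of_le [Min R] {s p : S} (hs : s ≠ 1) (hp : p ≠ 1) (h : s ≤ p) :
    (outer s hs : RigorousExtension S R) ⊓ outer p hp = outer s hs :=
  extend_outer_outer _ _ hs hp hs (inf_eq_left.2 h)

theorem outer_inf_outer_of_ge [Min R] {s p : S} (hs : s ≠ 1) (hp : p ≠ 1) (h : p ≤ s) :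
    (outer s hs : RigorousExtension S R) ⊓ outer p hp = outer p hp :=
  extend_outer_outer _ _ hs hp hp (inf_eq_right.2 h)

theorem outer_sup_outer_of_le [Max R] {s p : S} (hs : s ≠ 1) (hp : p ≠ 1) (h : s ≤ p) :
    (outer s hs : RigorousExtension S R) ⊔ outer p hp = outer p hp :=
  extend_outer_outer _ _ hs hp hp (sup_eq_right.2 h)

theorem compl_outer [Compl R] {s : S} (hs : s ≠ 1) (hs' : sᶜ ≠ 1) :
    (outer s hs : RigorousExtension S R)ᶜ = outer sᶜ hs' :=
  dif_neg hs'

/-- The interpretation of the term `σ` in `S[R(D)]`. -/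
def sigmaVal {D : Type u} :
    RigorousExtension S (Reflection D) → RigorousExtension S (Reflection D)
  | outer s hs => outer s hs
  | inner .bot => inner .bot
  | inner (.low a) => inner (.low a)
  | inner (.high _) => inner .top
  | inner .top => inner .top

end RigorousExtension

/-- The value of σ on the lower copy of D. It uses x** = x for x ≥ e, the defining law of
generalized Sugihara monoids. -/
theorem inf_one_mul_star_star {D : Type u} [RL D] (hD : IsGeneralizedSugiharaMonoid D)
    (hch : IsChainAlgebra D) (a : D) : (a ⊓ 1) * (((a ⇨ 1) ⊓ 1) ⇨ 1) = a := by
  rcases hch a 1 with h | h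
  · rw [inf_eq_left.2 h, inf_eq_right.2 (one_le_himp.2 h), one_himp', mul_one]
  · have h1 : a ⇨ 1 ≤ 1 := by simpa using himp_mono_anti h (le_refl (1 : D))
    have h2 := hD.star_star a
    rw [sup_eq_left.2 h] at h2
    rw [inf_eq_right.2 h, inf_eq_left.2 h1, h2, one_mul]

open RigorousExtension in
theorem IsRigorousReflection.satisfiesNegcone {B : Type u} [IRL B]
    (hB : IsRigorousReflection B) : SatisfiesNegcone B := by
  obtain ⟨S, D, _, _, hS, hSfsi, hD, hDfsi, φ, hφ, hbij⟩ := hB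
  have hSch := hS.isChainAlgebra hSfsi
  have hDch := hD.isChainAlgebra hDfsi
  have hone : (1 : S)ᶜ = 1 := hS.odd
  have hne : ∀ s : S, s ≠ 1 → sᶜ ≠ 1 := fun s hs h1 => hs (compl_injective' (h1.trans hone.symm))
  have hle : ∀ s : S, s ≤ 1 → 1 ≤ sᶜ := fun s h => by
    rw [← hone]; exact compl_le_compl_iff'.2 h
  have hge : ∀ s : S, 1 ≤ s → sᶜ ≤ 1 := fun s h => by
    rw [← hone]; exact compl_le_compl_iff'.2 h
  have hcompl : ∀ (s : S) (hs : s ≠ 1),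
      (outer s hs : RigorousExtension S (Reflection D))ᶜ = outer sᶜ (hne s hs) :=
    fun s hs => compl_outer hs _
  have honeE : (1 : RigorousExtension S (Reflection D)) = inner 1 := rfl
  have hfE : (1 : RigorousExtension S (Reflection D))ᶜ = inner (.high 1) := rfl
  have hcomplE : ∀ a : Reflection D,
      (inner a : RigorousExtension S (Reflection D))ᶜ = inner aᶜ := fun _ => rfl
  have hmulE : ∀ a b : Reflection D,
      (inner a : RigorousExtension S (Reflection D)) * inner b = inner (a * b) := fun _ _ => rfl
  have hsupE : ∀ a b : Reflection D,
      (inner a : RigorousExtension S (Reflection D)) ⊔ inner b = inner (a ⊔ b) := fun _ _ => rfl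
  have hsigma : ∀ x, φ (sigma x) = sigmaVal (φ x) := by
    intro x
    simp only [sigma, star, imp, hφ.map_mul, hφ.map_inf, hφ.map_compl, hφ.map_one]
    generalize φ x = y
    rcases y with ⟨s, hs⟩ | _ | a | a | _
    · rw [hfE, outer_mul_inner, hcompl, honeE]
      rcases hSch s 1 with h | h
      · rw [outer_inf_inner_of_le hs h, outer_inf_inner_of_ge _ (hle s h)]
        exact outer_mul_inner s hs _
      · rw [outer_inf_inner_of_ge hs h, outer_inf_inner_of_le _ (hge s h), outer_mul_inner, hcompl,
          inner_mul_outer]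
        simp [sigmaVal]
    · rfl
    · exact congrArg (fun b => inner (Reflection.low b)) (inf_one_mul_star_star hD hDch a)
    · rfl
    · rfl
  intro x
  apply hbij.1
  simp only [d, d', sigma', imp, f, pow_two, hφ.map_mul, hφ.map_inf, hφ.map_sup, hφ.map_compl,
    hφ.map_one, hsigma]
  generalize φ x = y
  rcases y with ⟨s, hs⟩ | _ | a | a | _
  · simp only [hfE, hcompl, sigmaVal, outer_mul_inner, inner_mul_outer, hmulE, hcomplE, hsupE,
      compl_compl_eq]
    -- On an outer s the first two joinands are s ∧ ¬s and the third is s, because outer elements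
    -- absorb f².
    rcases hSch s sᶜ with h | h <;>
      simp only [outer_inf_outer_of_le, outer_inf_outer_of_ge, outer_sup_outer_of_le, h, le_refl]
  -- On the reflection, once σ is known, both sides evaluate by the operation tables alone.
  · rfl
  · rfl
  · rfl
  · rfl

end Equation

end DeMorgan

open DeMorgan in
theorem mainTheorem2 {A : Type*} [DeMorgan.IRL A]
    (hA : DeMorgan.IsDeMorganMonoid A) (hlin : DeMorgan.IsSemilinear A) :
    List.TFAE [
      DeMorgan.IsNegativelyGenerated A,
      DeMorgan.IsSubdirectProductOf
        (fun B _ => DeMorgan.IsSugiharaChainOrRigorousReflection B) A,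
      DeMorgan.SatisfiesNegcone A] := by
  tfae_have 1 → 2 := by
    intro hneg
    obtain ⟨I, B, _, p, hch, hp, hsurj, hinj⟩ := hlin
    exact ⟨I, B, _, p, fun i => (hA.of_surjective (hp i)
      (hsurj i)).isSugiharaChainOrRigorousReflection (hch i)
      (hneg.of_surjective (hp i) (hsurj i)), hp, hsurj, hinj⟩
  tfae_have 2 → 3 := by
    rintro ⟨I, B, _, p, hB, hp, -, hinj⟩
    refine SatisfiesNegcone.of_forall hp hinj fun i => ?_
    rcases hB i with h | h
    · exact h.1.satisfiesNegcone h.2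
    · exact h.satisfiesNegcone
  tfae_have 3 → 1 := SatisfiesNegcone.isNegativelyGenerated
  tfae_finish
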